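/- Let $\mathbf{Man}$ be the category of finite-dimensional smooth manifolds (Hausdorff, second countable, without boundary) and smooth maps. For $U\in\mathbf{Man}$ let $\mathbf{Loc}_1^\infty(U)$ be the following category. An object is a pair $(\pi:M\to U,E)$ consisting of a locally trivializable smooth fiber bundle $\pi:M\to U$ whose typical fiber is a non-empty open interval $I\subseteq\mathbb{R}$, and a non-degenerate vertical $1$-form $E$ on $M$, i.e. a smooth family of linear functionals $E_m:\ker(d_m\pi)\to\mathbb{R}$, $m\in M$, each with trivial kernel. A morphism $f:(\pi:M\to U,E)\to(\pi':M'\to U,E')$ is a smooth map $f:M\to M'$ with $\pi' f=\pi$ and $f^\ast E'=E$ which is an open embedding of manifolds (a diffeomorphism onto an open submanifold of $M'$). A smooth map $h:U\to U'$ induces a functor $h^\ast:\mathbf{Loc}_1^\infty(U')\to\mathbf{Loc}_1^\infty(U)$: on objects, $h^\ast(\pi:M\to U',E):=(\pi_h:h^\ast M\to U,\ (\overline{h}^{M})^\ast E)$, where $h^\ast M=U\times_{U'}M$ is the pullback bundle with projection $\pi_h$ to $U$ and canonical map $\overline{h}^M:h^\ast M\to M$; on morphisms, $h^\ast f$ is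 the map of pullback bundles determined by $\pi'_h\circ h^\ast f=\pi_h$ and $\overline{h}^{M'}\circ h^\ast f=f\circ\overline{h}^M$. Together with the canonical coherence isomorphisms $h^\ast h'^\ast\cong(h'h)^\ast$ and $\mathrm{id}\cong\mathrm{id}_U^\ast$ given by the universal property of pullback bundles, this defines a pseudo-functor (prestack) $\mathbf{Loc}_1^\infty:\mathbf{Man}^{\mathrm{op}}\to\mathbf{Cat}$. **Proposition.** The prestack $\mathbf{Loc}_1^\infty$ is a stack: for every manifold $U$ and every open cover $\{U_\alpha\subseteq U\}$, the canonical functor $$\mathbf{Loc}_1^\infty(U)\longrightarrow\mathbf{Loc}_1^\infty(\{U_\alpha\subseteq U\}),\qquad x\longmapsto\big(\{x|_{U_\alpha}\},\{x|_{U_\beta}|_{U_\alpha\cap U_\beta}\cong x|_{U_\alpha}|_{U_\alpha\cap U_\beta}\}\big),\qquad \psi\longmapsto\{\psi|_{U_\alpha}\},$$ to the category of descent data is an equivalence of categories. Here a descent datum consists of objects $x_\alpha\in\mathbf{Loc}_1^\infty(U_\alpha)$ and isomorphisms $\varphi_{\alpha\beta}:x_\beta|_{U_\alpha\cap U_\beta}\to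 x_\alpha|_{U_\alpha\cap U_\beta}$ with, up to the coherence isomorphisms, $\varphi_{\alpha\alpha}=\mathrm{id}$ and $\varphi_{\alpha\beta}\,\varphi_{\beta\gamma}=\varphi_{\alpha\gamma}$ on $U_\alpha\cap U_\beta\cap U_\gamma$; a morphism of descent data is a family of morphisms $\psi_\alpha:x_\alpha\to x'_\alpha$ with $\varphi'_{\alpha\beta}\circ\psi_\beta|_{U_\alpha\cap U_\beta}=\psi_\alpha|_{U_\alpha\cap U_\beta}\circ\varphi_{\alpha\beta}$; and $|_V$ denotes pullback along the inclusion of an open subset $V$. -/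

import Mathlib

universe u w v₁ u₁

namespace SmoothLoc

noncomputable section

open scoped Manifold ContDiff
open Set TopologicalSpace CategoryTheory

/-! ### Manifolds from an atlas of local homeomorphisms into a manifold -/

section Atlas

/-- A family of local homeomorphisms from `P` to open subsets of a smooth manifold `N`,
whose sources cover `P` and whose transition maps are smooth. -/
structure ManifoldAtlas {E H : Type*} [NormedAddCommGroup E] [NormedSpace ℝ E] [TopologicalSpace H]
    (J : ModelWithCorners ℝ E H) (P N : Type*) [TopologicalSpace P] [TopologicalSpace N]
    [ChartedSpace H N] where
  charts : Set (OpenPartialHomeomorph P N)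
  chartAt : P → OpenPartialHomeomorph P N
  chartAt_mem : ∀ p, chartAt p ∈ charts
  mem_source : ∀ p, p ∈ (chartAt p).source
  smooth : ∀ e ∈ charts, ∀ e' ∈ charts,
    ContMDiffOn J J ∞ (fun x => e' (e.symm x)) (e.symm.trans e').source

namespace ManifoldAtlas

variable {E H : Type*} [NormedAddCommGroup E] [NormedSpace ℝ E] [TopologicalSpace H]
  {J : ModelWithCorners ℝ E H} {P N : Type*} [TopologicalSpace P] [TopologicalSpace N]
  [ChartedSpace H N] (A : ManifoldAtlas J P N)

/-- The charts of `P` are the members of the atlas followed by the charts of `N`. -/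
@[reducible]
def chartedSpace : ChartedSpace H P :=
  letI : ChartedSpace N P :=
    { atlas := A.charts
      chartAt := A.chartAt
      mem_chart_source := A.mem_source
      chart_mem_atlas := A.chartAt_mem }
  ChartedSpace.comp H N P

theorem isManifold [IsManifold J ∞ N] :
    letI := A.chartedSpace
    IsManifold J ∞ P := by
  let _ := A.chartedSpace
  apply isManifold_of_contDiffOn
  rintro _ _ ⟨e, he, c, hc, rfl⟩ ⟨e', he', c', hc', rfl⟩
  have h1 := contMDiffOn_symm_of_mem_maximalAtlas (I := J) (n := ∞)
    (StructureGroupoid.subset_maximalAtlas _ hc)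
  have h2 := contMDiffOn_of_mem_maximalAtlas (I := J) (n := ∞)
    (StructureGroupoid.subset_maximalAtlas _ hc')
  have h3 := A.smooth e he e' he'
  rw [← contMDiffOn_iff_contDiffOn]
  apply J.contMDiff.comp_contMDiffOn
  refine h2.comp (h3.comp (h1.comp (J.contMDiffOn_symm.mono (by simp)) ?_) ?_) ?_
  · intro x hx; simp at hx ⊢; grind
  · intro x hx; simp at hx ⊢; grind
  · intro x hx; simp at hx ⊢; grind

theorem contMDiffOn [IsManifold J ∞ N] {e : OpenPartialHomeomorph P N} (he : e ∈ A.charts) :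
    letI := A.chartedSpace
    ContMDiffOn J J ∞ e e.source := by
  let _ := A.chartedSpace
  have := A.isManifold
  intro p hp
  set c := _root_.chartAt H (e p)
  have hc : c ∈ atlas H N := chart_mem_atlas _ _
  have hec : e.trans c ∈ atlas H P := ⟨e, he, c, hc, rfl⟩
  have h1 := contMDiffOn_symm_of_mem_maximalAtlas (I := J) (n := ∞)
    (StructureGroupoid.subset_maximalAtlas _ hc)
  have h2 := contMDiffOn_of_mem_maximalAtlas (I := J) (n := ∞)
    (StructureGroupoid.subset_maximalAtlas _ hec)
  have hps : p ∈ (e.trans c).source := by simp [hp, c]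
  have h3 : ContMDiffOn J J ∞ (c.symm ∘ (e.trans c)) (e.trans c).source :=
    h1.comp h2 (fun x hx => by simp at hx ⊢; exact c.map_source hx.2)
  have h4 : ContMDiffAt J J ∞ (c.symm ∘ (e.trans c)) p :=
    h3.contMDiffAt ((e.trans c).open_source.mem_nhds hps)
  refine (h4.congr_of_eventuallyEq ?_).contMDiffWithinAt
  filter_upwards [(e.trans c).open_source.mem_nhds hps] with x hx
  simp at hx ⊢
  rw [c.left_inv hx.2]

theorem contMDiffOn_symm [IsManifold J ∞ N] {e : OpenPartialHomeomorph P N} (he : e ∈ A.charts) :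
    letI := A.chartedSpace
    ContMDiffOn J J ∞ e.symm e.target := by
  let _ := A.chartedSpace
  have := A.isManifold
  intro x hx
  set c := _root_.chartAt H x
  have hc : c ∈ atlas H N := chart_mem_atlas _ _
  have hec : e.trans c ∈ atlas H P := ⟨e, he, c, hc, rfl⟩
  have h1 := contMDiffOn_of_mem_maximalAtlas (I := J) (n := ∞)
    (StructureGroupoid.subset_maximalAtlas _ hc)
  have h2 := contMDiffOn_symm_of_mem_maximalAtlas (I := J) (n := ∞)
    (StructureGroupoid.subset_maximalAtlas _ hec)
  have hopen : IsOpen (e.target ∩ c.source) := e.open_target.inter c.open_source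
  have hxs : x ∈ e.target ∩ c.source := ⟨hx, by simp [c]⟩
  have h3 : ContMDiffOn J J ∞ ((e.trans c).symm ∘ c) (e.target ∩ c.source) :=
    h2.comp (h1.mono inter_subset_right) (fun y hy => by
      simp [c.map_source hy.2, c.left_inv hy.2, hy.1])
  have h4 : ContMDiffAt J J ∞ ((e.trans c).symm ∘ c) x := h3.contMDiffAt (hopen.mem_nhds hxs)
  refine (h4.congr_of_eventuallyEq ?_).contMDiffWithinAt
  filter_upwards [hopen.mem_nhds hxs] with y hy
  simp [c.left_inv hy.2]

end ManifoldAtlas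

end Atlas

/-! ### Pullback of smooth 1-forms -/

section OneForms

open Bundle

variable {E H : Type*} [NormedAddCommGroup E] [NormedSpace ℝ E] [TopologicalSpace H]
  {E' H' : Type*} [NormedAddCommGroup E'] [NormedSpace ℝ E'] [TopologicalSpace H']

/-- The 1-form `θ` on `M` is smooth on `W`, as a section of the cotangent bundle. -/
def SmoothOneFormOn (I : ModelWithCorners ℝ E H) {M : Type*} [TopologicalSpace M]
    [ChartedSpace H M] [IsManifold I ∞ M]
    (θ : ∀ m : M, TangentSpace I m →L[ℝ] ℝ) (W : Set M) : Prop :=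
  ContMDiffOn I (I.prod 𝓘(ℝ, E →L[ℝ] ℝ)) ∞
    (fun m => TotalSpace.mk' (E →L[ℝ] ℝ)
      (E := fun m : M => TangentSpace I m →L[ℝ] ℝ) m (θ m)) W

theorem SmoothOneFormOn.pullback {I : ModelWithCorners ℝ E H} {I' : ModelWithCorners ℝ E' H'}
    {M M' : Type*} [TopologicalSpace M] [ChartedSpace H M] [IsManifold I ∞ M]
    [TopologicalSpace M'] [ChartedSpace H' M'] [IsManifold I' ∞ M']
    {θ : ∀ m : M', TangentSpace I' m →L[ℝ] ℝ} {W : Set M'} (hW : IsOpen W)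
    (hθ : SmoothOneFormOn I' θ W) {f : M → M'} (hf : ContMDiff I I' ∞ f) :
    SmoothOneFormOn I (fun m => (θ (f m)).comp (mfderiv I I' f m)) (f ⁻¹' W) := by
  intro m₀ hm₀
  have h1 := hθ.contMDiffAt (hW.mem_nhds hm₀)
  rw [contMDiffAt_hom_bundle] at h1
  have h2 := h1.2.comp m₀ hf.contMDiffAt
  have h3 : ContMDiffAt I 𝓘(ℝ, E →L[ℝ] E') ∞
      (inTangentCoordinates I I' id f (mfderiv I I' f) m₀) m₀ :=
    ContMDiffAt.mfderiv_const (n := ∞) hf.contMDiffAt (by simp)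
  apply ContMDiffAt.contMDiffWithinAt
  rw [contMDiffAt_hom_bundle]
  refine ⟨contMDiffAt_id, (h2.clm_comp h3).congr_of_eventuallyEq ?_⟩
  have A : ∀ᶠ m in nhds m₀, f m ∈ (trivializationAt E' (TangentSpace I' : M' → Type _) (f m₀)).baseSet :=
    hf.continuous.continuousAt ((trivializationAt E' (TangentSpace I') (f m₀)).open_baseSet.mem_nhds
      (FiberBundle.mem_baseSet_trivializationAt' _))
  filter_upwards [A] with m hm
  ext v
  simp [inTangentCoordinates, ContinuousLinearMap.inCoordinates]
  exact congrArg _ ((trivializationAt E' (TangentSpace I') (f m₀)).symmL_continuousLinearMapAt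
    (R := ℝ) hm _).symm

end OneForms

/-! ### The category of manifolds -/

/-- A finite-dimensional smooth manifold: Hausdorff, second countable, without boundary. -/
structure Man : Type (u + 1) where
  carrier : Type u
  E : Type
  H : Type
  [normedAddCommGroup : NormedAddCommGroup E]
  [normedSpace : NormedSpace ℝ E]
  [finiteDimensional : FiniteDimensional ℝ E]
  [topModel : TopologicalSpace H]
  model : ModelWithCorners ℝ E H
  [boundaryless : model.Boundaryless]
  [top : TopologicalSpace carrier]
  [charted : ChartedSpace H carrier]
  [isManifold : IsManifold model ∞ carrier]
  [t2 : T2Space carrier]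
  [secondCountable : SecondCountableTopology carrier]

namespace Man

instance : CoeSort Man.{u} (Type u) := ⟨Man.carrier⟩

attribute [instance] normedAddCommGroup normedSpace finiteDimensional topModel boundaryless top
  charted isManifold t2 secondCountable

/-- Smooth maps. -/
@[ext]
structure Hom (M N : Man.{u}) : Type u where
  toFun : M → N
  smooth : ContMDiff M.model N.model ∞ toFun

instance : Quiver Man.{u} where
  Hom := Hom

instance : Category Man.{u} where
  id M := ⟨id, contMDiff_id⟩
  comp f g := ⟨g.toFun ∘ f.toFun, g.smooth.comp f.smooth⟩

instance (M N : Man.{u}) : CoeFun (M ⟶ N) (fun _ => M → N) := ⟨fun f => f.toFun⟩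

@[ext]
theorem hom_ext {M N : Man.{u}} {f g : M ⟶ N} (h : ∀ x, f x = g x) : f = g :=
  Hom.ext (funext h)

@[simp] theorem id_apply (M : Man.{u}) (x : M) : (𝟙 M : M ⟶ M) x = x := rfl

@[simp] theorem comp_apply {M N P : Man.{u}} (f : M ⟶ N) (g : N ⟶ P) (x : M) :
    (f ≫ g) x = g (f x) := rfl

theorem mdiff {M N : Man.{u}} (f : M ⟶ N) (x : M) : MDifferentiableAt M.model N.model f x :=
  f.smooth.mdifferentiableAt (by simp)

/-- An open subset of a manifold, as a manifold. -/
def ofOpens {U : Man.{u}} (V : Opens U) : Man.{u} where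
  carrier := V
  E := U.E
  H := U.H
  model := U.model

/-- The inclusion of an open subset. -/
def ofOpensι {U : Man.{u}} (V : Opens U) : ofOpens V ⟶ U where
  toFun := Subtype.val
  smooth := (contMDiff_subtype_val : ContMDiff U.model U.model ∞ (Subtype.val : V → U))

/-- The differential of a smooth map. -/
abbrev diff {M N : Man.{u}} (f : M ⟶ N) (x : M) :
    TangentSpace M.model x →L[ℝ] TangentSpace N.model (f x) :=
  mfderiv M.model N.model f x

theorem diff_comp {M N P : Man.{u}} (f : M ⟶ N) (g : N ⟶ P) (x : M) :
    diff (f ≫ g) x = (diff g (f x)).comp (diff f x) :=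
  mfderiv_comp x (mdiff g _) (mdiff f x)

theorem diff_id (M : Man.{u}) (x : M) :
    diff (𝟙 M) x = ContinuousLinearMap.id ℝ (TangentSpace M.model x) :=
  mfderiv_id

/-- `f` is an open embedding of manifolds, i.e. a diffeomorphism onto an open submanifold. -/
structure IsOpenEmb {M N : Man.{u}} (f : M ⟶ N) : Prop where
  isOpenEmbedding : Topology.IsOpenEmbedding f
  isLocalDiffeomorph : IsLocalDiffeomorph M.model N.model ∞ f

end Man

open Man

/-! ### Interval bundles and vertical 1-forms -/

section Bundles

variable {M U : Man.{u}}

/-- A local trivialization over an open subset of `U` with typical fiber the open subset `I` of `ℝ`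
is smooth if it is a diffeomorphism between its source and its target. -/
def IsSmoothTriv {π : M ⟶ U} {I : Opens ℝ} (e : Bundle.Trivialization I π) : Prop :=
  ContMDiffOn M.model (U.model.prod 𝓘(ℝ, ℝ)) ∞ e e.source ∧
    ContMDiffOn (U.model.prod 𝓘(ℝ, ℝ)) M.model ∞ e.toOpenPartialHomeomorph.symm e.target

/-- `π` is a locally trivializable smooth fiber bundle whose typical fiber is the open subset
`I` of `ℝ`. -/
def IsFiberBundleWith (π : M ⟶ U) (I : Opens ℝ) : Prop :=
  ∀ x : U, ∃ e : Bundle.Trivialization I π, x ∈ e.baseSet ∧ IsSmoothTriv e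

/-- `π` is a locally trivializable smooth fiber bundle whose typical fiber is an open interval. -/
def IsIntervalBundle (π : M ⟶ U) : Prop :=
  ∃ I : Opens ℝ, (I : Set ℝ).Nonempty ∧ (I : Set ℝ).OrdConnected ∧ IsFiberBundleWith π I

/-- The vertical tangent space `ker dπ` at `m`. -/
def VerticalSpace (π : M ⟶ U) (m : M) : Submodule ℝ (TangentSpace M.model m) :=
  LinearMap.ker (diff π m).toLinearMap

/-- A family of linear functionals on the vertical tangent spaces. -/
def VerticalForm (π : M ⟶ U) : Type u :=
  ∀ m : M, VerticalSpace π m →ₗ[ℝ] ℝ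

/-- A vertical 1-form is smooth if, locally on the total space, it is the restriction to
vertical vectors of a smooth 1-form. -/
def VerticalForm.IsSmooth {π : M ⟶ U} (ε : VerticalForm π) : Prop :=
  ∀ m₀ : M, ∃ (W : Set M) (θ : ∀ m : M, TangentSpace M.model m →L[ℝ] ℝ), IsOpen W ∧ m₀ ∈ W ∧
    SmoothOneFormOn M.model θ W ∧ ∀ m ∈ W, ∀ v : VerticalSpace π m, ε m v = θ m v

/-- A vertical 1-form is non-degenerate if it vanishes on no nonzero vertical vector. (The
vertical tangent spaces of an interval bundle are lines.) -/
def VerticalForm.IsNondegenerate {π : M ⟶ U} (ε : VerticalForm π) : Prop :=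
  ∀ (m : M) (v : VerticalSpace π m), ε m v = 0 → v = 0

variable {M' U' M'' U'' : Man.{u}}

/-- The differential of a bundle map `f` covering `h`, restricted to vertical vectors. -/
def verticalDiff {π : M ⟶ U} {π' : M' ⟶ U'} (f : M ⟶ M') (h : U ⟶ U') (w : f ≫ π' = π ≫ h)
    (m : M) : VerticalSpace π m →ₗ[ℝ] VerticalSpace π' (f m) :=
  (diff f m).toLinearMap.restrict (by
    intro v hv
    have hv' : diff π m v = 0 := hv
    have h1 : (diff π' (f m)).comp (diff f m) = (diff h (π m)).comp (diff π m) := by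
      rw [← diff_comp, ← diff_comp, w]
    change diff π' (f m) (diff f m v) = 0
    have h2 := congrArg (fun L => L v) h1
    exact h2.trans ((congrArg (diff h (π m)) hv').trans (map_zero _)))

/-- The pullback of a vertical 1-form along a bundle map `f` covering `h`. -/
def VerticalForm.pullback {π : M ⟶ U} {π' : M' ⟶ U'} (ε : VerticalForm π') (f : M ⟶ M')
    (h : U ⟶ U') (w : f ≫ π' = π ≫ h) : VerticalForm π :=
  fun m => (ε (f m)).comp (verticalDiff f h w m)

end Bundles

/-! ### Pullback bundles -/

section Pullback

variable {M U U' : Man.{u}}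

/-- The set underlying the pullback of `π : M ⟶ U'` along `h : U ⟶ U'`. -/
@[ext]
structure PullbackCarrier (h : U ⟶ U') (π : M ⟶ U') : Type u where
  fst : U
  snd : M
  w : h fst = π snd

namespace PullbackCarrier

variable {h : U ⟶ U'} {π : M ⟶ U'}

def toProd (p : PullbackCarrier h π) : U × M := (p.fst, p.snd)

/-- The subspace topology of `U × M`. -/
instance : TopologicalSpace (PullbackCarrier h π) := TopologicalSpace.induced toProd inferInstance

theorem isEmbedding_toProd :
    Topology.IsEmbedding (toProd : PullbackCarrier h π → U × M) where
  eq_induced := rfl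
  injective _ _ hpq := PullbackCarrier.ext (congrArg Prod.fst hpq) (congrArg Prod.snd hpq)

instance : T2Space (PullbackCarrier h π) := isEmbedding_toProd.t2Space

instance : SecondCountableTopology (PullbackCarrier h π) :=
  isEmbedding_toProd.isInducing.secondCountableTopology

theorem continuous_fst : Continuous (fst : PullbackCarrier h π → U) :=
  _root_.continuous_fst.comp isEmbedding_toProd.continuous

theorem continuous_snd : Continuous (snd : PullbackCarrier h π → M) :=
  _root_.continuous_snd.comp isEmbedding_toProd.continuous

end PullbackCarrier

open PullbackCarrier

theorem IsFiberBundleWith.surjective {π : M ⟶ U} {I : Opens ℝ} (hI : (I : Set ℝ).Nonempty)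
    (hπ : IsFiberBundleWith π I) : Function.Surjective π := by
  intro x
  obtain ⟨e, hx, -⟩ := hπ x
  obtain ⟨t, ht⟩ := hI
  exact ⟨_, e.proj_symm_apply' (x := ⟨t, ht⟩) hx⟩

variable (h : U ⟶ U') {π : M ⟶ U'} {I : Opens ℝ}

open Classical in
/-- The pullback of a local trivialization. (The surjectivity of `π` is only used for the values
of the inverse map outside of its domain.) -/
def pullbackTriv (hs : Function.Surjective π) (e : Bundle.Trivialization I π) :
    Bundle.Trivialization I (fst : PullbackCarrier h π → U) where
  toFun p := (p.fst, (e p.snd).2)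
  invFun x := ⟨x.1, if h x.1 ∈ e.baseSet then e.toOpenPartialHomeomorph.symm (h x.1, x.2)
    else Function.surjInv hs (h x.1), by
      split_ifs with hx
      · exact (e.proj_symm_apply' hx).symm
      · exact (Function.surjInv_eq hs _).symm⟩
  source := fst ⁻¹' (h ⁻¹' e.baseSet)
  target := (h ⁻¹' e.baseSet) ×ˢ univ
  map_source' p hp := ⟨hp, trivial⟩
  map_target' x hx := hx.1
  left_inv' p hp := by
    have hp' : h p.fst ∈ e.baseSet := hp
    apply PullbackCarrier.ext
    · rfl
    · change (if h p.fst ∈ e.baseSet then e.toOpenPartialHomeomorph.symm (h p.fst, (e p.snd).2)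
        else _) = p.snd
      rw [if_pos hp']
      rw [p.w] at hp' ⊢
      exact e.symm_apply_mk_proj (e.mem_source.2 hp')
  right_inv' x hx := by
    have hx' : h x.1 ∈ e.baseSet := hx.1
    refine Prod.ext rfl ?_
    change (e (if h x.1 ∈ e.baseSet then e.toOpenPartialHomeomorph.symm (h x.1, x.2)
        else _)).2 = x.2
    rw [if_pos hx', e.apply_symm_apply' hx']
  open_source := (e.open_baseSet.preimage h.smooth.continuous).preimage PullbackCarrier.continuous_fst
  open_target := (e.open_baseSet.preimage h.smooth.continuous).prod isOpen_univ
  continuousOn_toFun := by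
    refine PullbackCarrier.continuous_fst.continuousOn.prodMk ?_
    refine (_root_.continuous_snd.comp_continuousOn
      (e.toOpenPartialHomeomorph.continuousOn)).comp
      PullbackCarrier.continuous_snd.continuousOn ?_
    intro p hp
    exact e.mem_source.2 (p.w ▸ hp)
  continuousOn_invFun := by
    rw [isEmbedding_toProd.isInducing.continuousOn_iff]
    refine _root_.continuous_fst.continuousOn.prodMk ?_
    have h1 : ContinuousOn (fun x : U × I => e.toOpenPartialHomeomorph.symm (h x.1, x.2))
        ((h ⁻¹' e.baseSet) ×ˢ univ) := by
      refine e.toOpenPartialHomeomorph.symm.continuousOn.comp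
        ((h.smooth.continuous.comp _root_.continuous_fst).prodMk
          _root_.continuous_snd).continuousOn ?_
      intro x hx
      exact e.mem_target.2 hx.1
    exact h1.congr (fun x hx => if_pos hx.1)
  baseSet := h ⁻¹' e.baseSet
  open_baseSet := e.open_baseSet.preimage h.smooth.continuous
  source_eq := rfl
  target_eq := rfl
  proj_toFun _ _ := rfl

variable {h}

theorem pullbackTriv_apply (hs : Function.Surjective π) (e : Bundle.Trivialization I π)
    (p : PullbackCarrier h π) : pullbackTriv h hs e p = (p.fst, (e p.snd).2) := rfl

theorem snd_pullbackTriv_symm (hs : Function.Surjective π) (e : Bundle.Trivialization I π)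
    {x : U × I} (hx : h x.1 ∈ e.baseSet) :
    ((pullbackTriv h hs e).toOpenPartialHomeomorph.symm x).snd =
      e.toOpenPartialHomeomorph.symm (h x.1, x.2) := if_pos hx

variable (h)

/-- The manifold atlas on the pullback given by all pullbacks of smooth local trivializations. -/
def pullbackAtlas (hI : (I : Set ℝ).Nonempty) (hπ : IsFiberBundleWith π I) :
    ManifoldAtlas (U.model.prod 𝓘(ℝ, ℝ)) (PullbackCarrier h π) (U × I) where
  charts := {c | ∃ e : Bundle.Trivialization I π, IsSmoothTriv e ∧
    c = (pullbackTriv h (hπ.surjective hI) e).toOpenPartialHomeomorph}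
  chartAt p := (pullbackTriv h (hπ.surjective hI) (hπ (h p.fst)).choose).toOpenPartialHomeomorph
  chartAt_mem p := ⟨_, (hπ (h p.fst)).choose_spec.2, rfl⟩
  mem_source p := (hπ (h p.fst)).choose_spec.1
  smooth := by
    rintro _ ⟨e, he, rfl⟩ _ ⟨e', he', rfl⟩
    have h0 : ContMDiffOn (U.model.prod 𝓘(ℝ, ℝ)) 𝓘(ℝ, ℝ) ∞ (fun x : U × I =>
        (e' (e.toOpenPartialHomeomorph.symm (h x.1, x.2))).2)
        {x | h x.1 ∈ e.baseSet ∧ h x.1 ∈ e'.baseSet} := by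
      refine contMDiff_snd.comp_contMDiffOn (he'.1.comp (he.2.comp
        ((h.smooth.comp contMDiff_fst).prodMk contMDiff_snd).contMDiffOn ?_) ?_)
      · intro x hx
        exact e.mem_target.2 hx.1
      · intro x hx
        rw [mem_preimage, e'.mem_source]
        rw [e.proj_symm_apply' hx.1]
        exact hx.2
    refine (contMDiff_fst.contMDiffOn.prodMk (h0.mono ?_)).congr ?_
    · intro x hx
      exact ⟨hx.1.1, hx.2⟩
    · intro x hx
      refine Prod.ext rfl ?_
      change (e' ((pullbackTriv h _ e).toOpenPartialHomeomorph.symm x).snd).2 = _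
      rw [snd_pullbackTriv_symm _ _ hx.1.1]

/-- The pullback of an interval bundle, as a manifold. -/
def pullbackTotal (hπ : IsIntervalBundle π) : Man.{u} :=
  let A := pullbackAtlas h hπ.choose_spec.1 hπ.choose_spec.2.2
  { carrier := PullbackCarrier h π
    E := U.E × ℝ
    H := ModelProd U.H ℝ
    model := U.model.prod 𝓘(ℝ, ℝ)
    charted := A.chartedSpace
    isManifold := A.isManifold }


theorem isSmoothTriv_pullbackTriv (hπ : IsIntervalBundle π)
    (e : Bundle.Trivialization hπ.choose π) (he : IsSmoothTriv e) :
    ContMDiffOn (M := pullbackTotal h hπ) (pullbackTotal h hπ).model (U.model.prod 𝓘(ℝ, ℝ)) ∞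
      (pullbackTriv h (hπ.choose_spec.2.2.surjective hπ.choose_spec.1) e)
      (fst ⁻¹' (h ⁻¹' e.baseSet)) ∧
    ContMDiffOn (M' := pullbackTotal h hπ) (U.model.prod 𝓘(ℝ, ℝ)) (pullbackTotal h hπ).model ∞
      (pullbackTriv h (hπ.choose_spec.2.2.surjective
        hπ.choose_spec.1) e).toOpenPartialHomeomorph.symm
      ((h ⁻¹' e.baseSet) ×ˢ univ) :=
  ⟨(pullbackAtlas h hπ.choose_spec.1 hπ.choose_spec.2.2).contMDiffOn ⟨e, he, rfl⟩,
    (pullbackAtlas h hπ.choose_spec.1 hπ.choose_spec.2.2).contMDiffOn_symm ⟨e, he, rfl⟩⟩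

/-- The projection `π_h` of the pullback bundle to the base. -/
def pullbackFst (hπ : IsIntervalBundle π) : pullbackTotal h hπ ⟶ U where
  toFun := fst
  smooth := by
    intro p
    obtain ⟨e, hp, he⟩ := hπ.choose_spec.2.2 (h (fst p))
    have h1 := (isSmoothTriv_pullbackTriv h hπ e he).1
    have h2 : ContMDiffOn _ _ _ _ _ := contMDiff_fst.comp_contMDiffOn h1
    exact h2.contMDiffAt (IsOpen.mem_nhds
      ((e.open_baseSet.preimage h.smooth.continuous).preimage PullbackCarrier.continuous_fst) hp)

/-- The canonical map of the pullback bundle to the original bundle, covering `h`. -/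
def pullbackSnd (hπ : IsIntervalBundle π) : pullbackTotal h hπ ⟶ M where
  toFun := snd
  smooth := by
    intro p
    obtain ⟨e, hp, he⟩ := hπ.choose_spec.2.2 (h (fst p))
    have h1 := (isSmoothTriv_pullbackTriv h hπ e he).1
    have h2 : ContMDiffOn _ _ _ _ _ := he.2.comp
      (((h.smooth.comp contMDiff_fst).prodMk contMDiff_snd).comp_contMDiffOn h1)
      (fun q hq => e.mem_target.2 hq)
    refine ContMDiffAt.congr_of_eventuallyEq (h2.contMDiffAt (IsOpen.mem_nhds
      ((e.open_baseSet.preimage h.smooth.continuous).preimage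
        PullbackCarrier.continuous_fst) hp)) ?_
    filter_upwards [IsOpen.mem_nhds ((e.open_baseSet.preimage h.smooth.continuous).preimage
        PullbackCarrier.continuous_fst) hp] with q hq
    have hq' : h q.fst ∈ e.baseSet := hq
    change q.snd = e.toOpenPartialHomeomorph.symm (h q.fst, (e q.snd).2)
    rw [q.w] at hq' ⊢
    exact (e.symm_apply_mk_proj (e.mem_source.2 hq')).symm

theorem pullback_condition (hπ : IsIntervalBundle π) :
    pullbackSnd h hπ ≫ π = pullbackFst h hπ ≫ h :=
  Man.hom_ext fun p => (PullbackCarrier.w p).symm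

/-- A map into the pullback is smooth if both of its components are. -/
theorem pullbackTotal_contMDiffOn (hπ : IsIntervalBundle π) {E₀ H₀ Q : Type*}
    [NormedAddCommGroup E₀] [NormedSpace ℝ E₀] [TopologicalSpace H₀]
    {J : ModelWithCorners ℝ E₀ H₀} [TopologicalSpace Q] [ChartedSpace H₀ Q]
    {k : Q → pullbackTotal h hπ} {s : Set Q} (hs : IsOpen s)
    (h1 : ContMDiffOn J U.model ∞ (fun q => (k q).fst) s)
    (h2 : ContMDiffOn J M.model ∞ (fun q => (k q).snd) s) :
    ContMDiffOn J (pullbackTotal h hπ).model ∞ k s := by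
  intro q₀ hq₀
  obtain ⟨e, hp, he⟩ := hπ.choose_spec.2.2 (h (k q₀).fst)
  set T := pullbackTriv h (hπ.choose_spec.2.2.surjective hπ.choose_spec.1) e with hT
  have h3 := (isSmoothTriv_pullbackTriv h hπ e he).2
  have ho : IsOpen (s ∩ (fun q => (k q).fst) ⁻¹' (h ⁻¹' e.baseSet)) :=
    h1.continuousOn.isOpen_inter_preimage hs (e.open_baseSet.preimage h.smooth.continuous)
  have h4 : ContMDiffOn (M' := pullbackTotal h hπ) J (pullbackTotal h hπ).model ∞ (fun q =>
      T.toOpenPartialHomeomorph.symm ((k q).fst, (e (k q).snd).2))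
      (s ∩ (fun q => (k q).fst) ⁻¹' (h ⁻¹' e.baseSet)) := by
    refine h3.comp ((h1.mono inter_subset_left).prodMk
      (contMDiff_snd.comp_contMDiffOn (he.1.comp (h2.mono inter_subset_left) ?_))) ?_
    · intro q hq
      exact e.mem_source.2 ((PullbackCarrier.w (k q)) ▸ hq.2)
    · intro q hq
      exact ⟨hq.2, trivial⟩
  refine ((h4.contMDiffAt (ho.mem_nhds ⟨hq₀, hp⟩)).congr_of_eventuallyEq ?_).contMDiffWithinAt
  filter_upwards [ho.mem_nhds ⟨hq₀, hp⟩] with q hq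
  exact (T.toOpenPartialHomeomorph.left_inv hq.2).symm

/-- The universal property of the pullback. -/
def pullbackLift (hπ : IsIntervalBundle π) {Q : Man.{u}} (a : Q ⟶ U) (b : Q ⟶ M)
    (hab : a ≫ h = b ≫ π) : Q ⟶ pullbackTotal h hπ where
  toFun q := ⟨a q, b q, congrArg (fun k : Q ⟶ U' => k q) hab⟩
  smooth := contMDiffOn_univ.1 (pullbackTotal_contMDiffOn h hπ isOpen_univ
    a.smooth.contMDiffOn b.smooth.contMDiffOn)

theorem isIntervalBundle_pullbackFst (hπ : IsIntervalBundle π) :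
    IsIntervalBundle (pullbackFst h hπ) := by
  refine ⟨hπ.choose, hπ.choose_spec.1, hπ.choose_spec.2.1, fun x => ?_⟩
  obtain ⟨e, hp, he⟩ := hπ.choose_spec.2.2 (h x)
  exact ⟨pullbackTriv h (hπ.choose_spec.2.2.surjective hπ.choose_spec.1) e, hp,
    isSmoothTriv_pullbackTriv h hπ e he⟩

theorem eq_zero_of_diff_pullback (hπ : IsIntervalBundle π) (p : pullbackTotal h hπ)
    (v : TangentSpace (pullbackTotal h hπ).model p)
    (h1 : diff (pullbackFst h hπ) p v = 0) (h2 : diff (pullbackSnd h hπ) p v = 0) : v = 0 := by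
  obtain ⟨e, hp, he⟩ := hπ.choose_spec.2.2 (h (fst p))
  set T := pullbackTriv h (hπ.choose_spec.2.2.surjective hπ.choose_spec.1) e with hT
  let T' : pullbackTotal h hπ → U × hπ.choose := T
  let S' : U × hπ.choose → pullbackTotal h hπ := T.toOpenPartialHomeomorph.symm
  have hsm := isSmoothTriv_pullbackTriv h hπ e he
  have ho : IsOpen (fst ⁻¹' (h ⁻¹' e.baseSet) : Set (pullbackTotal h hπ)) :=
    (e.open_baseSet.preimage h.smooth.continuous).preimage PullbackCarrier.continuous_fst
  have hoT : IsOpen ((h ⁻¹' e.baseSet) ×ˢ (univ : Set hπ.choose)) :=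
    (e.open_baseSet.preimage h.smooth.continuous).prod isOpen_univ
  have hTd : MDifferentiableAt (pullbackTotal h hπ).model (U.model.prod 𝓘(ℝ, ℝ)) T' p :=
    (hsm.1.contMDiffAt (ho.mem_nhds hp)).mdifferentiableAt (by simp)
  have hTs : MDifferentiableAt (U.model.prod 𝓘(ℝ, ℝ)) (pullbackTotal h hπ).model
      S' (T' p) :=
    (hsm.2.contMDiffAt (x := T' p) (hoT.mem_nhds (show T' p ∈ _ from ⟨hp, trivial⟩))).mdifferentiableAt (by simp)
  have hed : MDifferentiableAt M.model (U'.model.prod 𝓘(ℝ, ℝ)) e (snd p) :=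
    (he.1.contMDiffAt (e.open_source.mem_nhds
      (e.mem_source.2 (p.w ▸ hp)))).mdifferentiableAt (by simp)
  have hsnd : MDifferentiableAt (U'.model.prod 𝓘(ℝ, ℝ)) 𝓘(ℝ, ℝ)
      (Prod.snd : U' × hπ.choose → hπ.choose) (e (snd p)) := mdifferentiableAt_snd
  have h3 : mfderiv (pullbackTotal h hπ).model (U.model.prod 𝓘(ℝ, ℝ)) T' p v = 0 := by
    have h4 : mfderiv (pullbackTotal h hπ).model (U.model.prod 𝓘(ℝ, ℝ)) T' p =
        (diff (pullbackFst h hπ) p).prod (mfderiv (pullbackTotal h hπ).model 𝓘(ℝ, ℝ)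
          ((Prod.snd ∘ e) ∘ (pullbackSnd h hπ)) p) :=
      mfderiv_prodMk (mdiff (pullbackFst h hπ) p) ((hsnd.comp _ hed).comp p (mdiff (pullbackSnd h hπ) p))
    have h7 : mfderiv (pullbackTotal h hπ).model 𝓘(ℝ, ℝ)
        ((Prod.snd ∘ e) ∘ (pullbackSnd h hπ)) p v = 0 :=
      (congrArg (fun L => L v) (mfderiv_comp p (hsnd.comp _ hed) (mdiff (pullbackSnd h hπ) p))).trans
        ((congrArg (mfderiv M.model 𝓘(ℝ, ℝ) (Prod.snd ∘ e) (snd p)) h2).trans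
          (map_zero (mfderiv M.model 𝓘(ℝ, ℝ) (Prod.snd ∘ e) (snd p))))
    exact (congrArg (fun L => L v) h4).trans (congrArg₂ (Prod.mk : U.E → ℝ → U.E × ℝ) h1 h7)
  have h5 : mfderiv (pullbackTotal h hπ).model (pullbackTotal h hπ).model
      (S' ∘ T') p v = 0 := by
    rw [mfderiv_comp p hTs hTd]
    exact (congrArg (mfderiv _ _ S' (T' p)) h3).trans (map_zero (mfderiv _ _ S' (T' p)))
  have h6 : S' ∘ T'
      =ᶠ[nhds p] id := by
    filter_upwards [ho.mem_nhds hp] with q hq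
    exact T.toOpenPartialHomeomorph.left_inv hq
  rw [h6.mfderiv_eq, mfderiv_id] at h5
  exact h5


theorem contMDiffOn_pullback_fst (hπ : IsIntervalBundle π) (s : Set (pullbackTotal h hπ)) :
    ContMDiffOn (M := pullbackTotal h hπ) (pullbackTotal h hπ).model U.model ∞ fst s :=
  (pullbackFst h hπ).smooth.contMDiffOn

theorem contMDiffOn_pullback_snd (hπ : IsIntervalBundle π) (s : Set (pullbackTotal h hπ)) :
    ContMDiffOn (M := pullbackTotal h hπ) (pullbackTotal h hπ).model M.model ∞ snd s :=
  (pullbackSnd h hπ).smooth.contMDiffOn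

/-- The map `h^* f` of pullback bundles induced by a bundle map `f`, by the universal property. -/
def pullbackMap {M' : Man.{u}} {π' : M' ⟶ U'} (hπ : IsIntervalBundle π)
    (hπ' : IsIntervalBundle π') (f : M ⟶ M') (w : f ≫ π' = π) :
    pullbackTotal h hπ ⟶ pullbackTotal h hπ' :=
  pullbackLift h hπ' (pullbackFst h hπ) (pullbackSnd h hπ ≫ f)
    (by rw [Category.assoc, w, pullback_condition])

open Classical in
theorem isOpenEmb_pullbackMap {M' : Man.{u}} {π' : M' ⟶ U'} (hπ : IsIntervalBundle π)
    (hπ' : IsIntervalBundle π') (f : M ⟶ M') (w : f ≫ π' = π) (hf : IsOpenEmb f) :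
    IsOpenEmb (pullbackMap h hπ hπ' f w) := by
  have hloc : IsLocalDiffeomorph (pullbackTotal h hπ).model (pullbackTotal h hπ').model ∞
      (pullbackMap h hπ hπ' f w) := by
    intro p
    obtain ⟨Φ, hp, hΦ⟩ := hf.isLocalDiffeomorph (snd p)
    have key : ∀ m' ∈ Φ.target, f (Φ.invFun m') = m' := fun m' hm' =>
      (hΦ (Φ.map_target' hm')).trans (Φ.right_inv' hm')
    let inv : pullbackTotal h hπ' → pullbackTotal h hπ := fun p' =>
      if hp' : snd p' ∈ Φ.target then
        ⟨fst p', Φ.invFun (snd p'), by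
          rw [← w, Man.comp_apply, key _ hp']; exact PullbackCarrier.w p'⟩
      else p
    have hinv1 : ∀ p', snd p' ∈ Φ.target → fst (inv p') = fst p' := fun p' hp' =>
      congrArg fst (dif_pos hp')
    have hinv2 : ∀ p', snd p' ∈ Φ.target → snd (inv p') = Φ.invFun (snd p') := fun p' hp' =>
      congrArg snd (dif_pos hp')
    have hso : IsOpen (snd ⁻¹' Φ.source : Set (pullbackTotal h hπ)) :=
      Φ.open_source.preimage PullbackCarrier.continuous_snd
    have hto : IsOpen (snd ⁻¹' Φ.target : Set (pullbackTotal h hπ')) :=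
      Φ.open_target.preimage PullbackCarrier.continuous_snd
    refine ⟨{ toFun := pullbackMap h hπ hπ' f w
              invFun := inv
              source := snd ⁻¹' Φ.source
              target := snd ⁻¹' Φ.target
              map_source' := ?_
              map_target' := ?_
              left_inv' := ?_
              right_inv' := ?_
              open_source := hso
              open_target := hto
              contMDiffOn_toFun := (pullbackMap h hπ hπ' f w).smooth.contMDiffOn
              contMDiffOn_invFun := ?_ }, hp, fun _ _ => rfl⟩
    · intro q hq
      change f (snd q) ∈ Φ.target
      rw [hΦ hq]
      exact Φ.map_source' hq
    · intro q hq
      change snd (inv q) ∈ Φ.source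
      rw [hinv2 q hq]
      exact Φ.map_target' hq
    · intro q hq
      have hq' : f (snd q) ∈ Φ.target := by
        rw [hΦ hq]
        exact Φ.map_source' hq
      refine PullbackCarrier.ext (hinv1 _ hq') ((hinv2 _ hq').trans ?_)
      change Φ.invFun (f (snd q)) = snd q
      rw [hΦ hq]
      exact Φ.left_inv' hq
    · intro q hq
      refine PullbackCarrier.ext (hinv1 _ hq) ?_
      change f (snd (inv q)) = snd q
      rw [hinv2 _ hq]
      exact key _ hq
    · exact pullbackTotal_contMDiffOn h hπ hto
        ((contMDiffOn_pullback_fst h hπ' _).congr hinv1)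
        ((Φ.contMDiffOn_invFun.comp (contMDiffOn_pullback_snd h hπ' _)
          (fun q hq => hq)).congr hinv2)
  refine ⟨.of_continuous_injective_isOpenMap (pullbackMap h hπ hπ' f w).smooth.continuous ?_
    hloc.isOpenMap, hloc⟩
  intro p q hpq
  have h1 := congrArg (fst : PullbackCarrier h π' → U) hpq
  have h2 := congrArg (snd : PullbackCarrier h π' → M') hpq
  exact PullbackCarrier.ext h1 (hf.isOpenEmbedding.injective h2)

end Pullback

section PullbackForm

variable {M U M' U' M'' U'' : Man.{u}} {π : M ⟶ U} {π' : M' ⟶ U'} {π'' : M'' ⟶ U''}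

theorem VerticalForm.ext {ε ε' : VerticalForm π} (h : ∀ m v, ε m v = ε' m v) : ε = ε' :=
  funext fun m => LinearMap.ext (h m)

theorem VerticalForm.pullback_pullback (ε : VerticalForm π'') (f : M ⟶ M') (h : U ⟶ U')
    (w : f ≫ π' = π ≫ h) (g : M' ⟶ M'') (k : U' ⟶ U'') (w' : g ≫ π'' = π' ≫ k)
    {l : M ⟶ M''} {j : U ⟶ U''} (w'' : l ≫ π'' = π ≫ j) (hl : f ≫ g = l) :
    (ε.pullback g k w').pullback f h w = ε.pullback l j w'' := by
  subst hl
  refine VerticalForm.ext fun m v => ?_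
  have h1 : verticalDiff g k w' (f m) (verticalDiff f h w m v) = verticalDiff (f ≫ g) j w'' m v :=
    Subtype.ext (congrArg (fun L => L v.1) (diff_comp f g m)).symm
  exact congrArg (ε (g (f m))) h1

theorem VerticalForm.pullback_id (ε : VerticalForm π) (h : U ⟶ U) (w : 𝟙 M ≫ π = π ≫ h) :
    ε.pullback (𝟙 M) h w = ε := by
  refine VerticalForm.ext fun m v => ?_
  have h1 : verticalDiff (𝟙 M) h w m v = v :=
    Subtype.ext (congrArg (fun L => L v.1) (diff_id M m))
  exact congrArg (ε m) h1

theorem VerticalForm.IsSmooth.pullback {ε : VerticalForm π'} (hε : ε.IsSmooth) (f : M ⟶ M')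
    (h : U ⟶ U') (w : f ≫ π' = π ≫ h) : (ε.pullback f h w).IsSmooth := by
  intro m₀
  obtain ⟨W, θ, hW, hm, hθ, heq⟩ := hε (f m₀)
  exact ⟨f ⁻¹' W, _, hW.preimage f.smooth.continuous, hm, hθ.pullback hW f.smooth,
    fun m hm v => heq _ hm _⟩

theorem VerticalForm.IsNondegenerate.pullback {ε : VerticalForm π'} (hε : ε.IsNondegenerate)
    (h : U ⟶ U') (hπ : IsIntervalBundle π') :
    (ε.pullback (pullbackSnd h hπ) h (pullback_condition h hπ)).IsNondegenerate := by
  intro p v hv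
  exact Subtype.ext (eq_zero_of_diff_pullback h hπ p v.1 v.2
    (congrArg Subtype.val (hε _ _ hv)))

end PullbackForm

/-! ### Smooth families of 1-dimensional spacetimes -/

/-- A smooth `U`-family of 1-dimensional spacetimes: an interval bundle `π : M ⟶ U` together with
a non-degenerate vertical 1-form. -/
structure Family (U : Man.{u}) : Type (u + 1) where
  total : Man.{u}
  proj : total ⟶ U
  isIntervalBundle : IsIntervalBundle proj
  form : VerticalForm proj
  isSmooth : form.IsSmooth
  isNondegenerate : form.IsNondegenerate

namespace Family

/-- A morphism of smooth `U`-families: a fiber bundle map over `U` that preserves the vertical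
1-forms and is an open embedding of total spaces. -/
@[ext]
structure Hom {U : Man.{u}} (X Y : Family U) : Type u where
  map : X.total ⟶ Y.total
  w : map ≫ Y.proj = X.proj
  preserves : Y.form.pullback map (𝟙 U) (w.trans (Category.comp_id _).symm) = X.form
  isOpenEmb : IsOpenEmb map


theorem _root_.SmoothLoc.Man.IsOpenEmb.id (M : Man.{u}) : IsOpenEmb (𝟙 M) :=
  ⟨Topology.IsOpenEmbedding.id, (Diffeomorph.refl M.model M ∞).isLocalDiffeomorph⟩

theorem _root_.SmoothLoc.Man.IsOpenEmb.comp {M N P : Man.{u}} {f : M ⟶ N} {g : N ⟶ P}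
    (hf : IsOpenEmb f) (hg : IsOpenEmb g) : IsOpenEmb (f ≫ g) :=
  ⟨hg.isOpenEmbedding.comp hf.isOpenEmbedding,
    fun x => (hf.isLocalDiffeomorph x).comp (K := P.model) (P := P) (hg.isLocalDiffeomorph (f x))⟩

theorem _root_.SmoothLoc.Man.IsOpenEmb.of_iso {M N : Man.{u}} (e : M ≅ N) : IsOpenEmb e.hom := by
  let Φ : Diffeomorph M.model N.model M N ∞ :=
    { toFun := e.hom
      invFun := e.inv
      left_inv := fun x => congrArg (fun k : M ⟶ M => k x) e.hom_inv_id
      right_inv := fun x => congrArg (fun k : N ⟶ N => k x) e.inv_hom_id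
      contMDiff_toFun := e.hom.smooth
      contMDiff_invFun := e.inv.smooth }
  exact ⟨Φ.toHomeomorph.isOpenEmbedding, Φ.isLocalDiffeomorph⟩

variable {U U' U'' : Man.{u}}

instance : Quiver (Family U) where
  Hom := Hom

instance : Category (Family U) where
  id X :=
    { map := 𝟙 X.total
      w := Category.id_comp _
      preserves := X.form.pullback_id _ _
      isOpenEmb := .id _ }
  comp {X Y Z} f g :=
    { map := f.map ≫ g.map
      w := by rw [Category.assoc, g.w, f.w]
      preserves := by
        rw [← f.preserves, ← g.preserves]
        exact (Z.form.pullback_pullback _ _ _ _ _ _ _ rfl).symm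
      isOpenEmb := f.isOpenEmb.comp g.isOpenEmb }
  id_comp f := Hom.ext (Category.id_comp f.map)
  comp_id f := Hom.ext (Category.comp_id f.map)
  assoc f g h := Hom.ext (Category.assoc f.map g.map h.map)

@[simp] theorem id_map (X : Family U) : Hom.map (𝟙 X) = 𝟙 X.total := rfl

@[simp] theorem comp_map {X Y Z : Family U} (f : X ⟶ Y) (g : Y ⟶ Z) :
    (f ≫ g).map = f.map ≫ g.map := rfl

theorem hom_ext {X Y : Family U} {f g : X ⟶ Y} (h : f.map = g.map) : f = g := Hom.ext h

/-- An isomorphism of families from a diffeomorphism over `U` that preserves the 1-forms. -/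
@[simps]
def isoMk {X Y : Family U} (e : X.total ≅ Y.total) (w : e.hom ≫ Y.proj = X.proj)
    (hp : Y.form.pullback e.hom (𝟙 U) (w.trans (Category.comp_id _).symm) = X.form) : X ≅ Y where
  hom := ⟨e.hom, w, hp, .of_iso e⟩
  inv := ⟨e.inv, by rw [← w, Iso.inv_hom_id_assoc], by
    rw [← hp, Y.form.pullback_pullback _ _ _ _ _ _ (j := 𝟙 U) (by simp) e.inv_hom_id,
      VerticalForm.pullback_id], .of_iso e.symm⟩
  hom_inv_id := hom_ext e.hom_inv_id
  inv_hom_id := hom_ext e.inv_hom_id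

/-- The pullback `h^* (π, E)` of a family: the pullback bundle with the pulled back 1-form. -/
def pullbackObj (h : U ⟶ U') (X : Family U') : Family U where
  total := pullbackTotal h X.isIntervalBundle
  proj := pullbackFst h X.isIntervalBundle
  isIntervalBundle := isIntervalBundle_pullbackFst h X.isIntervalBundle
  form := X.form.pullback (pullbackSnd h X.isIntervalBundle) h (pullback_condition h _)
  isSmooth := X.isSmooth.pullback _ _ _
  isNondegenerate := X.isNondegenerate.pullback h X.isIntervalBundle

/-- The functor `h^*`. -/
@[simps obj]
def pullbackFunctor (h : U ⟶ U') : Family U' ⥤ Family U where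
  obj := pullbackObj h
  map {X Y} f :=
    { map := pullbackMap h X.isIntervalBundle Y.isIntervalBundle f.map f.w
      w := rfl
      preserves := by
        have e : pullbackMap h X.isIntervalBundle Y.isIntervalBundle f.map f.w ≫
            pullbackSnd h Y.isIntervalBundle = pullbackSnd h X.isIntervalBundle ≫ f.map := rfl
        have w : (pullbackSnd h X.isIntervalBundle ≫ f.map) ≫ Y.proj =
            pullbackFst h X.isIntervalBundle ≫ h := by
          rw [Category.assoc, f.w, pullback_condition]
        refine (Y.form.pullback_pullback _ _ _ _ _ _ w e).trans ?_
        refine (Y.form.pullback_pullback (pullbackSnd h X.isIntervalBundle) h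
          (pullback_condition h X.isIntervalBundle) f.map (𝟙 _) (f.w.trans (Category.comp_id _).symm)
          w rfl).symm.trans ?_
        exact congrArg (fun ε => VerticalForm.pullback ε _ h
          (pullback_condition h X.isIntervalBundle)) f.preserves
      isOpenEmb := isOpenEmb_pullbackMap h _ _ _ _ f.isOpenEmb }
  map_id X := hom_ext rfl
  map_comp f g := hom_ext rfl

/-- The canonical isomorphism `X ≅ id^* X`. -/
def pullbackId (X : Family U) : (pullbackFunctor (𝟙 U)).obj X ≅ X :=
  isoMk
    { hom := pullbackSnd (𝟙 U) X.isIntervalBundle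
      inv := pullbackLift (𝟙 U) X.isIntervalBundle X.proj (𝟙 _) rfl
      hom_inv_id := Man.hom_ext fun p => PullbackCarrier.ext (PullbackCarrier.w p).symm rfl
      inv_hom_id := rfl }
    (pullback_condition (𝟙 U) X.isIntervalBundle) rfl

/-- The canonical isomorphism `(h' h)^* X ≅ h^* h'^* X`. -/
def pullbackComp (h : U ⟶ U') (h' : U' ⟶ U'') (X : Family U'') :
    (pullbackFunctor (h ≫ h')).obj X ≅ (pullbackFunctor h).obj ((pullbackFunctor h').obj X) :=
  isoMk
    { hom := pullbackLift h (X.pullbackObj h').isIntervalBundle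
        (pullbackFst (h ≫ h') X.isIntervalBundle)
        (pullbackLift h' X.isIntervalBundle (pullbackFst (h ≫ h') X.isIntervalBundle ≫ h)
          (pullbackSnd (h ≫ h') X.isIntervalBundle) (pullback_condition _ _).symm)
        rfl
      inv := pullbackLift (h ≫ h') X.isIntervalBundle
        (pullbackFst h (X.pullbackObj h').isIntervalBundle)
        (pullbackSnd h (X.pullbackObj h').isIntervalBundle ≫ pullbackSnd h' X.isIntervalBundle)
        (Man.hom_ext fun p => (congrArg h' (PullbackCarrier.w p)).trans
          (PullbackCarrier.w (PullbackCarrier.snd p)))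
      hom_inv_id := rfl
      inv_hom_id := Man.hom_ext fun p => PullbackCarrier.ext rfl
        (PullbackCarrier.ext (PullbackCarrier.w p) rfl) }
    rfl (by
      refine (VerticalForm.pullback_pullback _ _ _ _ _ _ _ (j := h) ?_ rfl).trans
        (X.form.pullback_pullback _ _ _ _ _ _ (pullback_condition (h ≫ h') _) rfl)
      rfl)

end Family

open Bicategory Opposite

/-- The prestack `U ↦ Loc₁^∞(U)`, `h ↦ h^*`. -/
def loc : Pseudofunctor (LocallyDiscrete Man.{u}ᵒᵖ) Cat.{u, u + 1} :=
  LocallyDiscrete.mkPseudofunctor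
    (fun U => Cat.of (Family U.unop))
    (fun h => (Family.pullbackFunctor h.unop).toCatHom)
    (fun U => Cat.Hom.isoMk (NatIso.ofComponents Family.pullbackId))
    (fun h h' => Cat.Hom.isoMk (NatIso.ofComponents (Family.pullbackComp h'.unop h.unop)))
    (fun f g h => by
      ext X
      apply Family.hom_ext
      apply Man.hom_ext
      intro p
      simp
      rfl)
    (fun h => by
      ext X
      apply Family.hom_ext
      simp
      rfl)
    (fun h => by
      ext X
      apply Family.hom_ext
      simp
      rfl)

/-- A prestack `X` on the category of manifolds is a stack if, for every manifold `U` and every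
open cover `V` of `U`, the canonical functor from `X(U)` to the category of descent data for the
inclusions `V i ⟶ U` is an equivalence of categories. (Descent data for these inclusions consist
of objects over the `V i` and compatible isomorphisms over every manifold that maps to both `V i`
and `V j` over `U`, i.e. over every manifold that maps to `V i ∩ V j`, subject to the cocycle
conditions.) -/
def IsStack (X : Pseudofunctor (LocallyDiscrete Man.{u}ᵒᵖ) Cat.{v₁, u₁}) : Prop :=
  ∀ (U : Man.{u}) (ι : Type w) (V : ι → Opens U), ⨆ i, V i = ⊤ →
    (X.toDescentData (fun i => ofOpensι (V i))).IsEquivalence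

end

end SmoothLoc

namespace SmoothLoc

noncomputable section

open scoped Manifold ContDiff
open Set TopologicalSpace CategoryTheory Man Opposite

/-! ### Open intervals are diffeomorphic to the real line -/

section Interval

/-! All the structure in a family is local on the base, so families and their morphisms glue. The
preimages of the `V i` form an open cover of the total space, and restricting a family to `V i`
amounts to passing to one of these open submanifolds (`isOpenEmb_pullbackSnd`).

Full faithfulness. A morphism is determined by its values at points, and every point lies over some
`V i`. Conversely, compatible maps over the `V i` glue to a smooth map (`exists_glue`). Being a map
over `U`, being a local diffeomorphism and preserving the forms can all be checked on the parts.
Injectivity is not a local condition, but it holds here: two points with the same image lie in one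
fibre, hence over one `V i`, where the map is injective.

Essential surjectivity. The total spaces of a descent datum are glued along the transition maps;
normalization and the cocycle condition make the identification an equivalence relation
(`DescentRel`). The quotient is Hausdorff, because points over different points of `U` are separated
in `U`, while points over the same point lie in one Hausdorff open part. It is second countable,
because `U` is Lindelöf. The vertical forms agree on overlaps and therefore glue. The only point
special to interval bundles is that the typical fibre may vary with `i`: every non-empty open
interval is diffeomorphic to `ℝ` (`nonempty_diffeomorph_interval`), so `ℝ` serves as a common fibre,
and `U × ℝ` as a common model for the charts of the glued space.

A point of a pullback is a pair, and the coherence isomorphisms do not move its underlying point of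
the total space. Identities between maps of iterated pullbacks are therefore checked on this
component. -/

theorem exists_contDiff_bounded {a b : ℝ} (hab : a < b) :
    ∃ f g : ℝ → ℝ, ContDiff ℝ ∞ f ∧ ContDiffOn ℝ ∞ g (Ioo a b) ∧ (∀ x, f x ∈ Ioo a b) ∧
      (∀ x, g (f x) = x) ∧ ∀ y ∈ Ioo a b, f (g y) = y := by
  have hr : 0 < (b - a) / 2 := by linarith
  -- The interval is the ball around its midpoint, and `univBall` maps the whole line
  -- diffeomorphically onto that ball.
  have hball : Metric.ball ((a + b) / 2) ((b - a) / 2) = Ioo a b := by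
    rw [Real.ball_eq_Ioo]; congr 1 <;> ring
  have ht := (OpenPartialHomeomorph.univBall_target ((a + b) / 2) hr).trans hball
  have hs : (OpenPartialHomeomorph.univBall ((a + b) / 2) ((b - a) / 2)).source = univ :=
    OpenPartialHomeomorph.univBall_source _ _
  refine ⟨OpenPartialHomeomorph.univBall ((a + b) / 2) ((b - a) / 2),
    (OpenPartialHomeomorph.univBall ((a + b) / 2) ((b - a) / 2)).symm,
    OpenPartialHomeomorph.contDiff_univBall, ?_, fun x => ?_, fun x => ?_, fun y hy => ?_⟩
  · rw [← hball]; exact OpenPartialHomeomorph.contDiffOn_univBall_symm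
  · rw [← ht]; exact OpenPartialHomeomorph.map_source _ (by rw [hs]; trivial)
  · exact OpenPartialHomeomorph.left_inv _ (by rw [hs]; trivial)
  · exact OpenPartialHomeomorph.right_inv _ (by rw [ht]; exact hy)

theorem exists_contDiff_Ioi (a : ℝ) :
    ∃ f g : ℝ → ℝ, ContDiff ℝ ∞ f ∧ ContDiffOn ℝ ∞ g (Ioi a) ∧ (∀ x, f x ∈ Ioi a) ∧
      (∀ x, g (f x) = x) ∧ ∀ y ∈ Ioi a, f (g y) = y := by
  refine ⟨fun x => a + Real.exp x, fun y => Real.log (y - a),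
    contDiff_const.add Real.contDiff_exp, ?_, fun x => ?_, fun x => by simp, fun y hy => ?_⟩
  · exact (contDiffOn_id.sub contDiffOn_const).log fun y hy => (sub_pos.2 hy).ne'
  · simp [Real.exp_pos]
  · simp [Real.exp_log (sub_pos.2 hy)]

theorem exists_contDiff_Iio (b : ℝ) :
    ∃ f g : ℝ → ℝ, ContDiff ℝ ∞ f ∧ ContDiffOn ℝ ∞ g (Iio b) ∧ (∀ x, f x ∈ Iio b) ∧
      (∀ x, g (f x) = x) ∧ ∀ y ∈ Iio b, f (g y) = y := by
  refine ⟨fun x => b - Real.exp x, fun y => Real.log (b - y),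
    contDiff_const.sub Real.contDiff_exp, ?_, fun x => ?_, fun x => by simp, fun y hy => ?_⟩
  · exact (contDiffOn_const.sub contDiffOn_id).log fun y hy => (sub_pos.2 hy).ne'
  · simp [Real.exp_pos]
  · simp [Real.exp_log (sub_pos.2 hy)]

/-- A non-empty open interval is one of `Ioo a b`, `Ioi a`, `Iio b`, `ℝ`. -/
theorem eq_of_isOpen_of_ordConnected {s : Set ℝ} (ho : IsOpen s) (hne : s.Nonempty)
    (hs : s.OrdConnected) :
    (∃ a b, a < b ∧ s = Ioo a b) ∨ (∃ a, s = Ioi a) ∨ (∃ b, s = Iio b) ∨ s = univ := by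
  have hp : _root_.IsPreconnected s := hs.isPreconnected
  -- Openness puts a midpoint slightly below `x` into `s`, so the infimum is not attained; the
  -- supremum is treated in the same way.
  have hinf : BddBelow s → s ⊆ Ioi (sInf s) := by
    intro hb x hx
    obtain ⟨y, hy, hys⟩ := (mem_nhdsLT_iff_exists_Ioo_subset).1
      (mem_nhdsWithin_of_mem_nhds (ho.mem_nhds hx))
    exact (csInf_le hb (hys ⟨by simpa using (left_lt_add_div_two.2 hy), add_div_two_lt_right.2 hy⟩)).trans_lt
      (add_div_two_lt_right.2 hy)
  have hsup : BddAbove s → s ⊆ Iio (sSup s) := by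
    intro hb x hx
    obtain ⟨y, hy, hys⟩ := (mem_nhdsGT_iff_exists_Ioo_subset).1
      (mem_nhdsWithin_of_mem_nhds (ho.mem_nhds hx))
    exact (left_lt_add_div_two.2 hy).trans_le
      (le_csSup hb (hys ⟨left_lt_add_div_two.2 hy, add_div_two_lt_right.2 hy⟩))
  by_cases hb : BddBelow s <;> by_cases ha : BddAbove s
  · obtain ⟨x, hx⟩ := hne
    exact .inl ⟨sInf s, sSup s, lt_trans (hinf hb hx) (hsup ha hx),
      Subset.antisymm (fun y hy => ⟨hinf hb hy, hsup ha hy⟩)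
        (IsConnected.Ioo_csInf_csSup_subset ⟨⟨x, hx⟩, hp⟩ hb ha)⟩
  · exact .inr (.inl ⟨sInf s, Subset.antisymm (hinf hb) (hp.Ioi_csInf_subset hb ha)⟩)
  · exact .inr (.inr (.inl ⟨sSup s, Subset.antisymm (hsup ha) (hp.Iio_csSup_subset hb ha)⟩))
  · exact .inr (.inr (.inr (hp.eq_univ_of_unbounded hb ha)))

theorem exists_contDiff_interval {s : Set ℝ} (ho : IsOpen s) (hne : s.Nonempty)
    (hs : s.OrdConnected) :
    ∃ f g : ℝ → ℝ, ContDiff ℝ ∞ f ∧ ContDiffOn ℝ ∞ g s ∧ (∀ x, f x ∈ s) ∧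
      (∀ x, g (f x) = x) ∧ ∀ y ∈ s, f (g y) = y := by
  rcases eq_of_isOpen_of_ordConnected ho hne hs with ⟨a, b, hab, rfl⟩ | ⟨a, rfl⟩ | ⟨b, rfl⟩ | rfl
  · exact exists_contDiff_bounded hab
  · exact exists_contDiff_Ioi a
  · exact exists_contDiff_Iio b
  · exact ⟨id, id, contDiff_id, contDiffOn_id, fun _ => trivial, fun _ => rfl, fun _ _ => rfl⟩

/-- A non-empty open interval is diffeomorphic to the real line. -/
theorem nonempty_diffeomorph_interval {I : Opens ℝ} (hne : (I : Set ℝ).Nonempty)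
    (hI : (I : Set ℝ).OrdConnected) :
    Nonempty (Diffeomorph 𝓘(ℝ, ℝ) 𝓘(ℝ, ℝ) I (⊤ : Opens ℝ) ∞) := by
  obtain ⟨f, g, hf, hg, hfI, hgf, hfg⟩ := exists_contDiff_interval I.isOpen hne hI
  refine ⟨{ toFun := fun x => ⟨g x, trivial⟩
            invFun := fun y => ⟨f y, hfI y⟩
            left_inv := fun x => Subtype.ext (hfg x x.2)
            right_inv := fun y => Subtype.ext (hgf y)
            contMDiff_toFun := ?_
            contMDiff_invFun := ?_ }⟩
  · rw [← ContMDiff.subtypeVal_comp_iff]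
    intro x
    exact (contMDiffAt_subtype_iff (f := g)).2
      (hg.contDiffAt (I.isOpen.mem_nhds x.2)).contMDiffAt
  · rw [← ContMDiff.subtypeVal_comp_iff]
    intro x
    exact (contMDiffAt_subtype_iff (f := f)).2 hf.contDiffAt.contMDiffAt

end Interval

/-! ### Local diffeomorphisms and open embeddings -/

section LocalDiffeomorph

variable {E H E' H' E'' H'' : Type*} [NormedAddCommGroup E] [NormedSpace ℝ E] [TopologicalSpace H]
  [NormedAddCommGroup E'] [NormedSpace ℝ E'] [TopologicalSpace H']
  [NormedAddCommGroup E''] [NormedSpace ℝ E''] [TopologicalSpace H'']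
  {I : ModelWithCorners ℝ E H} {I' : ModelWithCorners ℝ E' H'} {I'' : ModelWithCorners ℝ E'' H''}
  {M M' M'' : Type*} [TopologicalSpace M] [ChartedSpace H M] [TopologicalSpace M']
  [ChartedSpace H' M'] [TopologicalSpace M''] [ChartedSpace H'' M'']

theorem _root_.IsLocalDiffeomorphAt.congr_of_eventuallyEq {f g : M → M'} {m : M}
    (hf : IsLocalDiffeomorphAt I I' ∞ f m) (h : g =ᶠ[nhds m] f) :
    IsLocalDiffeomorphAt I I' ∞ g m := by
  obtain ⟨Φ, hm, hΦ⟩ := hf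
  obtain ⟨W, hW, hWo, hmW⟩ := eventually_nhds_iff.1 h
  -- The partial diffeomorphism `Φ` is shrunk to the open set `W` on which `g` and `f` agree.
  have ho : IsOpen (Φ.target ∩ Φ.invFun ⁻¹' W) :=
    Φ.contMDiffOn_invFun.continuousOn.isOpen_inter_preimage Φ.open_target hWo
  refine ⟨{ toFun := Φ.toFun
            invFun := Φ.invFun
            source := Φ.source ∩ W
            target := Φ.target ∩ Φ.invFun ⁻¹' W
            map_source' := fun x hx => ⟨Φ.map_source' hx.1, by
              rw [mem_preimage, Φ.left_inv' hx.1]; exact hx.2⟩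
            map_target' := fun x hx => ⟨Φ.map_target' hx.1, hx.2⟩
            left_inv' := fun x hx => Φ.left_inv' hx.1
            right_inv' := fun x hx => Φ.right_inv' hx.1
            open_source := Φ.open_source.inter hWo
            open_target := ho
            contMDiffOn_toFun := Φ.contMDiffOn_toFun.mono inter_subset_left
            contMDiffOn_invFun := Φ.contMDiffOn_invFun.mono inter_subset_left },
    ⟨hm, hmW⟩, fun x hx => (hW x hx.2).trans (hΦ hx.1)⟩

/-- Near `f m` the map `g` is `g ∘ f` after the local inverse of `f`. This is what allows smoothness
of a glued map to be tested on the parts; `of_comp` below does the same for local diffeomorphisms.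
-/
theorem _root_.IsLocalDiffeomorphAt.contMDiffAt_of_comp {f : M → M'} {g : M' → M''} {m : M}
    (hf : IsLocalDiffeomorphAt I I' ∞ f m) (h : ContMDiffAt I I'' ∞ (g ∘ f) m) :
    ContMDiffAt I' I'' ∞ g (f m) := by
  have hm : hf.localInverse (f m) = m := hf.localInverse_left_inv hf.localInverse_mem_target
  have h1 : ContMDiffAt I' I'' ∞ ((g ∘ f) ∘ hf.localInverse) (f m) :=
    ContMDiffAt.comp (f m) (by rw [hm]; exact h) hf.localInverse_contMDiffAt
  refine h1.congr_of_eventuallyEq ?_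
  filter_upwards [hf.localInverse_eventuallyEq_right] with x hx
  exact (congrArg g hx).symm

theorem _root_.IsLocalDiffeomorphAt.of_comp {f : M → M'} {g : M' → M''} {m : M}
    (hf : IsLocalDiffeomorphAt I I' ∞ f m) (h : IsLocalDiffeomorphAt I I'' ∞ (g ∘ f) m) :
    IsLocalDiffeomorphAt I' I'' ∞ g (f m) := by
  have hm : hf.localInverse (f m) = m := hf.localInverse_left_inv hf.localInverse_mem_target
  have h1 : IsLocalDiffeomorphAt I' I'' ∞ ((g ∘ f) ∘ hf.localInverse) (f m) :=
    hf.localInverse_isLocalDiffeomorphAt.comp (K := I'') (P := M'') (by rw [hm]; exact h)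
  refine h1.congr_of_eventuallyEq ?_
  filter_upwards [hf.localInverse_eventuallyEq_right] with x hx
  exact (congrArg g hx).symm

end LocalDiffeomorph

namespace Man

variable {M N Q : Man.{u}}

/-- A smooth map into the image of an open embedding factors smoothly through it. -/
theorem IsOpenEmb.exists_lift {f : M ⟶ N} (hf : IsOpenEmb f) (k : Q ⟶ N)
    (hk : ∀ q, k q ∈ range f) : ∃ r : Q ⟶ M, r ≫ f = k := by
  choose r hr using hk
  -- The lift is chosen pointwise. It is continuous because `f` is inducing, and this continuity
  -- keeps it in the domain of a local inverse of `f`, with which it then agrees after `k`.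
  have hc : Continuous r := hf.isOpenEmbedding.isInducing.continuous_iff.2
    ((funext hr : f.toFun ∘ r = k) ▸ k.smooth.continuous)
  refine ⟨⟨r, fun q => ?_⟩, Man.hom_ext hr⟩
  have h := hf.isLocalDiffeomorph (r q)
  have h1 : ContMDiffAt Q.model M.model ∞ (h.localInverse ∘ k) q :=
    ContMDiffAt.comp q (by rw [← hr q]; exact h.localInverse_contMDiffAt) k.smooth.contMDiffAt
  refine h1.congr_of_eventuallyEq ?_
  filter_upwards [hc.continuousAt h.localInverse_eventuallyEq_left] with x hx
  exact hx.symm.trans (congrArg h.localInverse (hr x))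

theorem IsOpenEmb.of_injective {f : M ⟶ N} (hf : IsLocalDiffeomorph M.model N.model ∞ f)
    (hi : Function.Injective f) : IsOpenEmb f :=
  ⟨.of_continuous_injective_isOpenMap f.smooth.continuous hi hf.isOpenMap, hf⟩

/-- A surjective open embedding is a diffeomorphism. -/
theorem IsOpenEmb.exists_iso {f : M ⟶ N} (hf : IsOpenEmb f) (hs : Function.Surjective f) :
    ∃ e : M ≅ N, e.hom = f := by
  obtain ⟨r, hr⟩ := hf.exists_lift (𝟙 N) fun q => hs q
  refine ⟨⟨f, r, Man.hom_ext fun x => hf.isOpenEmbedding.injective ?_, hr⟩, rfl⟩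
  exact congrArg (fun k : N ⟶ N => k (f x)) hr

/-- Smooth maps glue along a jointly surjective family of open embeddings. -/
theorem exists_glue {ι : Type*} {A : ι → Man.{u}} (k : ∀ i, A i ⟶ M) (hk : ∀ i, IsOpenEmb (k i))
    (hs : ∀ m, ∃ i a, k i a = m) (g : ∀ i, A i ⟶ Q)
    (hg : ∀ i j a b, k i a = k j b → g i a = g j b) : ∃ f : M ⟶ Q, ∀ i, k i ≫ f = g i := by
  -- Each point gets a chosen preimage in some part; by `hg` the value does not depend on the
  -- choice.
  choose c a ha using hs
  have key : ∀ i b, g (c (k i b)) (a (k i b)) = g i b := fun i b => hg _ _ _ _ (ha _)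
  refine ⟨⟨fun m => g (c m) (a m), fun m => ?_⟩, fun i => Man.hom_ext (key i)⟩
  have h1 := ((hk (c m)).isLocalDiffeomorph (a m)).contMDiffAt_of_comp (I'' := Q.model)
    (g := fun m => g (c m) (a m))
    ((g (c m)).smooth.contMDiffAt.congr_of_eventuallyEq (.of_forall (key (c m))))
  rwa [ha m] at h1

theorem isOpenEmb_ofOpensι {U : Man.{u}} (V : Opens U) : IsOpenEmb (ofOpensι V) := by
  refine .of_injective (fun x => ?_) Subtype.val_injective
  classical
  -- The value `x` off `V` is arbitrary: smoothness is only needed on the open set `V`.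
  let inv : U → V := fun y => if h : y ∈ V then ⟨y, h⟩ else x
  have hinv : ∀ y (h : y ∈ V), inv y = ⟨y, h⟩ := fun y h => dif_pos h
  refine ⟨{ toFun := Subtype.val
            invFun := inv
            source := univ
            target := V
            map_source' := fun y _ => y.2
            map_target' := fun _ _ => trivial
            left_inv' := fun y _ => hinv _ y.2
            right_inv' := fun y hy => congrArg Subtype.val (hinv y hy)
            open_source := isOpen_univ
            open_target := V.isOpen
            contMDiffOn_toFun := (ofOpensι V).smooth.contMDiffOn
            contMDiffOn_invFun := ?_ }, trivial, fun _ _ => rfl⟩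
  intro y hy
  refine ContMDiffAt.contMDiffWithinAt ?_
  refine (ContMDiffAt.subtypeVal_comp_iff (I := U.model) (I' := U.model) V inv y).1 ?_
  refine (contMDiffAt_id (I := U.model)).congr_of_eventuallyEq ?_
  filter_upwards [V.isOpen.mem_nhds hy] with z hz
  exact congrArg Subtype.val (hinv z hz)

end Man

open Man

/-- The pullback along an open embedding is diffeomorphic to the open submanifold `R` of `M` lying
over the image of `h`. Both directions of the diffeomorphism come from universal properties: `k`
from that of the pullback, `t` from lifting along the inclusion of `R`. -/
theorem isOpenEmb_pullbackSnd {M U U' : Man.{u}} {π : M ⟶ U'} (h : U ⟶ U') (hh : IsOpenEmb h)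
    (hπ : IsIntervalBundle π) : IsOpenEmb (pullbackSnd h hπ) := by
  refine .of_injective (fun p => ?_) fun p q hpq => PullbackCarrier.ext
    (hh.isOpenEmbedding.injective ?_) hpq
  · have ho : IsOpen (π ⁻¹' range h) := hh.isOpenEmbedding.isOpen_range.preimage π.smooth.continuous
    let R : Opens M := ⟨_, ho⟩
    obtain ⟨r, hr⟩ := hh.exists_lift (ofOpensι R ≫ π) fun q => q.2
    let k : ofOpens R ⟶ pullbackTotal h hπ := pullbackLift h hπ r (ofOpensι R) hr
    have hks : k ≫ pullbackSnd h hπ = ofOpensι R := rfl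
    obtain ⟨t, ht⟩ := (isOpenEmb_ofOpensι R).exists_lift (pullbackSnd h hπ) fun p =>
      ⟨⟨p.snd, p.fst, p.w⟩, rfl⟩
    have htp : k (t p) = p := PullbackCarrier.ext
      (hh.isOpenEmbedding.injective ((PullbackCarrier.w _).trans
        ((congrArg π (congrArg (fun f : pullbackTotal h hπ ⟶ M => f p) ht)).trans p.w.symm)))
      (congrArg (fun f : pullbackTotal h hπ ⟶ M => f p) ht)
    have hinv1 : k ≫ t = 𝟙 _ := Man.hom_ext fun q => (isOpenEmb_ofOpensι R).isOpenEmbedding.injective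
      (congrArg (fun f : pullbackTotal h hπ ⟶ M => f (k q)) ht)
    have hinv2 : t ≫ k = 𝟙 _ := Man.hom_ext fun q => PullbackCarrier.ext
      (hh.isOpenEmbedding.injective ((PullbackCarrier.w _).trans
        ((congrArg π (congrArg (fun f : pullbackTotal h hπ ⟶ M => f q) ht)).trans
          (PullbackCarrier.w q).symm)))
      (congrArg (fun f : pullbackTotal h hπ ⟶ M => f q) ht)
    have := ((IsOpenEmb.of_iso ⟨t, k, hinv2, hinv1⟩).comp (isOpenEmb_ofOpensι R)).isLocalDiffeomorph p
    rwa [show (⟨t, k, hinv2, hinv1⟩ : _ ≅ _).hom ≫ ofOpensι R = pullbackSnd h hπ from ht] at this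
  · exact (PullbackCarrier.w p).trans ((congrArg π hpq).trans (PullbackCarrier.w q).symm)

/-! ### Vertical 1-forms and local diffeomorphisms -/

section Forms

variable {M U M' U' : Man.{u}} {π : M ⟶ U} {π' : M' ⟶ U'}

theorem _root_.SmoothLoc.Man.IsOpenEmb.diff_bijective {f : M ⟶ M'} (hf : IsOpenEmb f) (m : M) :
    Function.Bijective (diff f m) :=
  ((hf.isLocalDiffeomorph m).mfderivToContinuousLinearEquiv (by simp)).bijective

/-- The full differential of `f` is bijective. Surjectivity on vertical vectors also uses that `dh`
is injective: if `df v` is vertical, then `dh (dπ v) = 0`, so `v` is vertical. -/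
theorem verticalDiff_bijective {f : M ⟶ M'} (hf : IsOpenEmb f) {h : U ⟶ U'} (hh : IsOpenEmb h)
    (w : f ≫ π' = π ≫ h) (m : M) : Function.Bijective (verticalDiff f h w m) := by
  constructor
  · intro v v' hv
    exact Subtype.ext ((hf.diff_bijective m).1 (congrArg Subtype.val hv))
  · rintro ⟨v, hv⟩
    obtain ⟨v, rfl⟩ := (hf.diff_bijective m).2 v
    have h1 : (diff π' (f m)).comp (diff f m) = (diff h (π m)).comp (diff π m) := by
      rw [← diff_comp, ← diff_comp, w]
    have h2 : diff h (π m) (diff π m v) = 0 :=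
      (congrArg (fun L : TangentSpace M.model m →L[ℝ] TangentSpace U'.model _ => L v) h1).symm.trans hv
    exact ⟨⟨v, (hh.diff_bijective (π m)).1 (h2.trans (map_zero _).symm)⟩, rfl⟩

/-- Vertical 1-forms are determined by their pullbacks along a jointly surjective family of open
embeddings. -/
theorem VerticalForm.ext_of_cover {ι : Type*} {A B : ι → Man.{u}} {ρ : ∀ i, A i ⟶ B i}
    (k : ∀ i, A i ⟶ M) (hk : ∀ i, IsOpenEmb (k i)) (h : ∀ i, B i ⟶ U) (hh : ∀ i, IsOpenEmb (h i))
    (w : ∀ i, k i ≫ π = ρ i ≫ h i) (hs : ∀ m, ∃ i a, k i a = m) {ε ε' : VerticalForm π}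
    (hε : ∀ i, ε.pullback (k i) (h i) (w i) = ε'.pullback (k i) (h i) (w i)) : ε = ε' := by
  refine VerticalForm.ext fun m v => ?_
  obtain ⟨i, a, rfl⟩ := hs m
  obtain ⟨v, rfl⟩ := (verticalDiff_bijective (hk i) (hh i) (w i) a).2 v
  exact congrArg (fun L => L v) (congrFun (hε i) a)

end Forms

/-! ### Gluing of manifolds -/

/-- Manifolds `part i`, all modelled on the manifold `model`, glued along open embeddings
`left i j` and `right i j` of manifolds `overlap i j` into `part i` and `part j`. The underlying
set of the result is given together with the maps from the parts. -/
structure ManGluing (ι : Type w) where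
  part : ι → Man.{u}
  carrier : Type u
  incl : ∀ i, part i → carrier
  incl_injective : ∀ i, Function.Injective (incl i)
  incl_surjective : ∀ p, ∃ i a, incl i a = p
  overlap : ι → ι → Man.{u}
  left : ∀ i j, overlap i j ⟶ part i
  right : ∀ i j, overlap i j ⟶ part j
  isOpenEmb_left : ∀ i j, IsOpenEmb (left i j)
  isOpenEmb_right : ∀ i j, IsOpenEmb (right i j)
  incl_eq_iff : ∀ i j a b, incl i a = incl j b ↔ ∃ p, left i j p = a ∧ right i j p = b
  model : Man.{u}
  exists_chart : ∀ i a, ∃ e : OpenPartialHomeomorph (part i) model, a ∈ e.source ∧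
    ContMDiffOn (part i).model model.model ∞ e e.source ∧
    ContMDiffOn model.model (part i).model ∞ e.symm e.target

namespace ManGluing

variable {ι : Type w} (D : ManGluing.{u} ι)

instance : TopologicalSpace D.carrier := ⨆ i, .coinduced (D.incl i) inferInstance

theorem continuous_iff {X : Type*} [TopologicalSpace X] {f : D.carrier → X} :
    Continuous f ↔ ∀ i, Continuous (f ∘ D.incl i) := by
  simp only [continuous_iSup_dom, continuous_coinduced_dom]

theorem isOpen_iff {W : Set D.carrier} : IsOpen W ↔ ∀ i, IsOpen (D.incl i ⁻¹' W) := by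
  simp only [isOpen_iSup_iff, isOpen_coinduced]

/-- The trace on part `j` of the image of an open subset `W` of part `i` is `right i j '' (left i j
⁻¹' W)`, which is open because `right i j` is an open map. -/
theorem isOpenEmbedding_incl (i : ι) : Topology.IsOpenEmbedding (D.incl i) := by
  refine .of_continuous_injective_isOpenMap (D.continuous_iff.1 continuous_id i)
    (D.incl_injective i) fun W hW => D.isOpen_iff.2 fun j => ?_
  have h : D.incl j ⁻¹' (D.incl i '' W) = D.right i j '' (D.left i j ⁻¹' W) := by
    ext b
    constructor
    · rintro ⟨a, ha, hab⟩
      obtain ⟨p, rfl, rfl⟩ := (D.incl_eq_iff _ _ _ _).1 hab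
      exact ⟨p, ha, rfl⟩
    · rintro ⟨p, hp, rfl⟩
      exact ⟨_, hp, (D.incl_eq_iff _ _ _ _).2 ⟨p, rfl, rfl⟩⟩
  rw [h]
  exact (D.isOpenEmb_right i j).isOpenEmbedding.isOpenMap _
    (hW.preimage (D.left i j).smooth.continuous)

/-- The local homeomorphisms to the model that are smooth on all parts. -/
def charts : Set (OpenPartialHomeomorph D.carrier D.model) :=
  {c | (∀ i, ContMDiffOn (D.part i).model D.model.model ∞ (c ∘ D.incl i)
      (D.incl i ⁻¹' c.source)) ∧
    ∀ x ∈ c.target, ∃ (i : ι) (s : D.model → D.part i),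
      ContMDiffAt D.model.model (D.part i).model ∞ s x ∧ D.incl i ∘ s =ᶠ[nhds x] c.symm}

/-- A chart `e` of one part is transported along `incl i`. It is smooth on every other part because
the overlap maps are local diffeomorphisms. The map `s` records `e.symm`, from which the smooth
local inverse of `incl i` is built later. -/
theorem exists_mem_charts (i : ι) (a : D.part i) :
    ∃ c ∈ D.charts, D.incl i a ∈ c.source ∧
      ∃ s : D.model → D.part i, ContMDiffOn D.model.model (D.part i).model ∞ s c.target ∧
        ∀ b, D.incl i b ∈ c.source → s (c (D.incl i b)) = b := by
  obtain ⟨e, ha, he, he'⟩ := D.exists_chart i a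
  have : Nonempty (D.part i) := ⟨a⟩
  set k := (D.isOpenEmbedding_incl i).toOpenPartialHomeomorph with hk
  have hkl : ∀ b, k.symm (D.incl i b) = b := fun b => k.left_inv (x := b) (by simp [hk])
  have hs : ∀ b, D.incl i b ∈ (k.symm.trans e).source ↔ b ∈ e.source := by
    intro b
    have hkt : k.target = range (D.incl i) := by simp [hk]
    simp [hkl, hkt]
  refine ⟨k.symm.trans e, ⟨fun j b hb => ?_, fun x hx => ?_⟩, (hs a).2 ha, e.symm, ?_, ?_⟩
  · obtain ⟨⟨a', ha'⟩, -⟩ : D.incl j b ∈ range (D.incl i) ∧ _ := by simpa [hk] using hb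
    obtain ⟨p, rfl, rfl⟩ := (D.incl_eq_iff _ _ _ _).1 ha'
    have hp : D.left i j p ∈ e.source := by
      rw [← hs, ha']
      exact hb
    have h1 : ContMDiffAt (D.overlap i j).model D.model.model ∞ (e ∘ D.left i j) p :=
      (he.contMDiffAt (e.open_source.mem_nhds hp)).comp p (D.left i j).smooth.contMDiffAt
    -- Smoothness on part `j` is tested after `right i j`, where the transported chart becomes `e ∘
    -- left i j`.
    refine (((D.isOpenEmb_right i j).isLocalDiffeomorph p).contMDiffAt_of_comp
      (h1.congr_of_eventuallyEq (.of_forall fun q => ?_))).contMDiffWithinAt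
    change e (k.symm (D.incl j (D.right i j q))) = e (D.left i j q)
    rw [← (D.incl_eq_iff _ _ _ _).2 ⟨q, rfl, rfl⟩, hkl]
  · have hx' : x ∈ e.target := by simpa [hk] using hx
    exact ⟨i, e.symm, he'.contMDiffAt (e.open_target.mem_nhds hx'), .of_forall fun y => rfl⟩
  · exact he'.mono fun x hx => by simpa [hk] using hx
  · intro b hb
    change e.symm (e (k.symm (D.incl i b))) = b
    rw [hkl]
    exact e.left_inv ((hs b).1 hb)

theorem exists_mem_charts' (p : D.carrier) : ∃ c ∈ D.charts, p ∈ c.source := by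
  obtain ⟨i, a, rfl⟩ := D.incl_surjective p
  obtain ⟨c, hc, ha, -⟩ := D.exists_mem_charts i a
  exact ⟨c, hc, ha⟩

def manifoldAtlas : ManifoldAtlas D.model.model D.carrier D.model where
  charts := D.charts
  chartAt p := (D.exists_mem_charts' p).choose
  chartAt_mem p := (D.exists_mem_charts' p).choose_spec.1
  mem_source p := (D.exists_mem_charts' p).choose_spec.2
  smooth := by
    intro c hc c' hc' x hx
    -- Near `x` the transition map is `(c' ∘ incl i) ∘ s`, a composite of smooth maps through one
    -- part.
    obtain ⟨i, s, hs, hsc⟩ := hc.2 x hx.1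
    have hsx : D.incl i (s x) = c.symm x := hsc.eq_of_nhds
    have h1 := (hc'.1 i).contMDiffAt (x := s x)
      (IsOpen.mem_nhds (c'.open_source.preimage (D.isOpenEmbedding_incl i).continuous)
        (by rw [mem_preimage, hsx]; exact hx.2))
    refine ((h1.comp x hs).congr_of_eventuallyEq ?_).contMDiffWithinAt
    filter_upwards [hsc] with y hy
    exact (congrArg c' hy).symm

/-- The manifold that results from the gluing. -/
def total [T2Space D.carrier] [SecondCountableTopology D.carrier] : Man.{u} where
  carrier := D.carrier
  E := D.model.E
  H := D.model.H
  model := D.model.model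
  charted := D.manifoldAtlas.chartedSpace
  isManifold := D.manifoldAtlas.isManifold

variable [T2Space D.carrier] [SecondCountableTopology D.carrier]

theorem isLocalDiffeomorph_incl (i : ι) :
    IsLocalDiffeomorph (M := D.part i) (N := D.total) (D.part i).model D.total.model ∞
      (D.incl i) := by
  intro a
  obtain ⟨c, hc, ha, s, hs, hsc⟩ := D.exists_mem_charts i a
  have hc1 : ContMDiffOn (M := D.total) D.total.model D.model.model ∞ c c.source :=
    D.manifoldAtlas.contMDiffOn hc
  have hc2 : ContMDiffOn (M' := D.total) D.model.model D.total.model ∞ c.symm c.target :=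
    D.manifoldAtlas.contMDiffOn_symm hc
  have ho : IsOpen (D.incl i ⁻¹' c.source) :=
    c.open_source.preimage (D.isOpenEmbedding_incl i).continuous
  have hro : IsOpen (range (D.incl i)) := (D.isOpenEmbedding_incl i).isOpen_range
  refine ⟨{ toFun := D.incl i
            invFun := s ∘ c
            source := D.incl i ⁻¹' c.source
            target := c.source ∩ range (D.incl i)
            map_source' := fun b hb => ⟨hb, b, rfl⟩
            map_target' := ?_
            left_inv' := hsc
            right_inv' := ?_
            open_source := ho
            open_target := c.open_source.inter hro
            contMDiffOn_toFun := ?_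
            contMDiffOn_invFun := ?_ }, ha, fun _ _ => rfl⟩
  · rintro _ ⟨hb, b, rfl⟩
    change D.incl i (s (c (D.incl i b))) ∈ c.source
    rwa [hsc b hb]
  · rintro _ ⟨hb, b, rfl⟩
    exact congrArg (D.incl i) (hsc b hb)
  · exact (hc2.comp (hc.1 i) fun b hb => c.map_source hb).congr fun b hb =>
      (c.left_inv hb).symm
  · exact hs.comp (hc1.mono inter_subset_left) fun b hb => c.map_source hb.1

/-- The inclusion of a part into the glued manifold. -/
def inclHom (i : ι) : D.part i ⟶ D.total where
  toFun := D.incl i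
  smooth := (D.isLocalDiffeomorph_incl i).contMDiff

theorem isOpenEmb_inclHom (i : ι) : IsOpenEmb (D.inclHom i) :=
  ⟨D.isOpenEmbedding_incl i, D.isLocalDiffeomorph_incl i⟩

end ManGluing

/-! ### Hausdorffness and second countability of a glued space over a base -/

section Separation

variable {ι : Type w} (D : ManGluing.{u} ι) {B : Type*} [TopologicalSpace B] {pr : D.carrier → B}
  {V : ι → Opens B}

/-- Points over different points of `B` are separated by preimages of open sets of `B`. Points over
the same point lie in a common part, since each part is a full preimage, and that part is open and
Hausdorff. -/
theorem ManGluing.t2Space [T2Space B] (hpr : Continuous pr)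
    (hV : ∀ i, range (D.incl i) = pr ⁻¹' V i) : T2Space D.carrier := by
  refine ⟨fun p q hpq => ?_⟩
  by_cases h : pr p = pr q
  · obtain ⟨i, a, rfl⟩ := D.incl_surjective p
    obtain ⟨b, rfl⟩ : q ∈ range (D.incl i) := by
      rw [hV, mem_preimage, ← h]
      exact (hV i).subset (mem_range_self a)
    obtain ⟨W, W', hW, hW', ha, hb, hd⟩ := t2_separation (ne_of_apply_ne _ hpq)
    have hi := D.isOpenEmbedding_incl i
    exact ⟨_, _, hi.isOpenMap _ hW, hi.isOpenMap _ hW', mem_image_of_mem _ ha,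
      mem_image_of_mem _ hb, (disjoint_image_iff hi.injective).2 hd⟩
  · obtain ⟨W, W', hW, hW', ha, hb, hd⟩ := t2_separation h
    exact ⟨_, _, hW.preimage hpr, hW'.preimage hpr, ha, hb, hd.preimage pr⟩

/-- A second countable base is hereditarily Lindelöf, so countably many `V i` have the same union as
all of them, and countably many second countable open parts cover the glued space. -/
theorem ManGluing.secondCountableTopology [SecondCountableTopology B]
    (hV : ∀ i, range (D.incl i) = pr ⁻¹' V i) : SecondCountableTopology D.carrier := by
  obtain ⟨T, hT, hTV⟩ := isOpen_iUnion_countable (fun i => (V i : Set B)) fun i => (V i).isOpen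
  have := hT.to_subtype
  have (i : T) : SecondCountableTopology (range (D.incl i)) :=
    (D.isOpenEmbedding_incl i).isEmbedding.toHomeomorph.symm.isEmbedding.isInducing.secondCountableTopology
  refine secondCountableTopology_of_countable_cover
    (U := fun i : T => range (D.incl i)) (fun i => (D.isOpenEmbedding_incl i).isOpen_range) ?_
  refine eq_univ_of_forall fun p => ?_
  obtain ⟨i, a, rfl⟩ := D.incl_surjective p
  have h : pr (D.incl i a) ∈ ⋃ i ∈ T, (V i : Set B) :=
    hTV ▸ mem_iUnion.2 ⟨i, (hV i).subset (mem_range_self a)⟩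
  obtain ⟨j, hj, hpj⟩ := mem_iUnion₂.1 h
  exact mem_iUnion.2 ⟨⟨j, hj⟩, (hV j).symm ▸ hpj⟩

end Separation

/-! ### Gluing of vertical 1-forms -/

section OneForms

open Bundle

variable {E H : Type*} [NormedAddCommGroup E] [NormedSpace ℝ E] [TopologicalSpace H]
  {E' H' : Type*} [NormedAddCommGroup E'] [NormedSpace ℝ E'] [TopologicalSpace H']

/-- The version for a map smooth only on an open set is needed to pull forms back along local
inverses. -/
theorem SmoothOneFormOn.pullback_of_contMDiffOn {I : ModelWithCorners ℝ E H}
    {I' : ModelWithCorners ℝ E' H'} {M M' : Type*} [TopologicalSpace M] [ChartedSpace H M]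
    [IsManifold I ∞ M] [TopologicalSpace M'] [ChartedSpace H' M'] [IsManifold I' ∞ M']
    {θ : ∀ m : M', TangentSpace I' m →L[ℝ] ℝ} {W : Set M'} (hW : IsOpen W)
    (hθ : SmoothOneFormOn I' θ W) {f : M → M'} {s : Set M} (hs : IsOpen s)
    (hf : ContMDiffOn I I' ∞ f s) :
    SmoothOneFormOn I (fun m => (θ (f m)).comp (mfderiv I I' f m)) (s ∩ f ⁻¹' W) := by
  rintro m₀ ⟨hs₀, hm₀⟩
  have hf₀ := hf.contMDiffAt (hs.mem_nhds hs₀)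
  have h1 := hθ.contMDiffAt (hW.mem_nhds hm₀)
  rw [contMDiffAt_hom_bundle] at h1
  have h2 := h1.2.comp m₀ hf₀
  have h3 : ContMDiffAt I 𝓘(ℝ, E →L[ℝ] E') ∞
      (inTangentCoordinates I I' id f (mfderiv I I' f) m₀) m₀ :=
    ContMDiffAt.mfderiv_const (n := ∞) hf₀ (by simp)
  apply ContMDiffAt.contMDiffWithinAt
  rw [contMDiffAt_hom_bundle]
  refine ⟨contMDiffAt_id, (h2.clm_comp h3).congr_of_eventuallyEq ?_⟩
  have A : ∀ᶠ m in nhds m₀, f m ∈ (trivializationAt E' (TangentSpace I' : M' → Type _) (f m₀)).baseSet :=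
    hf₀.continuousAt ((trivializationAt E' (TangentSpace I') (f m₀)).open_baseSet.mem_nhds
      (FiberBundle.mem_baseSet_trivializationAt' _))
  filter_upwards [A] with m hm
  ext v
  simp [inTangentCoordinates, ContinuousLinearMap.inCoordinates]
  exact congrArg _ ((trivializationAt E' (TangentSpace I') (f m₀)).symmL_continuousLinearMapAt
    (R := ℝ) hm _).symm

end OneForms

section Forms

variable {M U : Man.{u}} {π : M ⟶ U}

/-- If two open embeddings into `M` agree on an overlap and the pullbacks of two vertical 1-forms
to this overlap agree, then these forms take the same values on vectors with the same image. -/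
theorem VerticalForm.apply_eq_of_overlap {A B A' B' P R : Man.{u}} {ρ : A ⟶ B} {ρ' : A' ⟶ B'}
    {τ : P ⟶ R} (ε : VerticalForm ρ) (ε' : VerticalForm ρ') {k : A ⟶ M} {k' : A' ⟶ M}
    (hk' : IsOpenEmb k')
    {l : P ⟶ A} (hl : IsOpenEmb l) {h : R ⟶ B} (hh : IsOpenEmb h) (wl : l ≫ ρ = τ ≫ h)
    {r : P ⟶ A'} {h' : R ⟶ B'} (wr : r ≫ ρ' = τ ≫ h') (hlr : l ≫ k = r ≫ k')
    (hε : ε.pullback l h wl = ε'.pullback r h' wr) (p : P) (v : VerticalSpace ρ (l p))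
    (v' : VerticalSpace ρ' (r p))
    (hv : (diff k (l p) v.1 : M.E) = (diff k' (r p) v'.1 : M.E)) : ε (l p) v = ε' (r p) v' := by
  obtain ⟨v, rfl⟩ := (verticalDiff_bijective hl hh wl p).2 v
  -- The points `k (l p)` and `k' (r p)` agree only through `hlr`, so their tangent vectors are
  -- compared in the model space `M.E`.
  have h1 : (diff k (l p) (diff l p v.1) : M.E) = (diff k' (r p) (diff r p v.1) : M.E) := by
    have e1 := congrArg (fun L => (L v.1 : M.E)) (diff_comp l k p)
    have e2 := congrArg (fun L => (L v.1 : M.E)) (diff_comp r k' p)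
    have e3 : (diff (l ≫ k) p v.1 : M.E) = (diff (r ≫ k') p v.1 : M.E) := by rw [hlr]
    exact e1.symm.trans (e3.trans e2)
  have h2 : verticalDiff r h' wr p v = v' :=
    Subtype.ext ((hk'.diff_bijective (r p)).1 (h1.symm.trans hv))
  exact (congrArg (fun L => L v) (congrFun hε p)).trans (congrArg (ε' (r p)) h2)

variable {ι : Type w} {A B : ι → Man.{u}} {ρ : ∀ i, A i ⟶ B i}
  {k : ∀ i, A i ⟶ M} {h : ∀ i, B i ⟶ U}

/-- Vertical 1-forms glue along a jointly surjective family of open embeddings. -/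
theorem VerticalForm.exists_glue
    (hk : ∀ i, IsOpenEmb (k i)) (hh : ∀ i, IsOpenEmb (h i)) (w : ∀ i, k i ≫ π = ρ i ≫ h i)
    (hs : ∀ m, ∃ i a, k i a = m) (ε : ∀ i, VerticalForm (ρ i))
    (hε : ∀ i j a b, k i a = k j b → ∀ (v : VerticalSpace (ρ i) a) (v' : VerticalSpace (ρ j) b),
      (diff (k i) a v.1 : M.E) = (diff (k j) b v'.1 : M.E) → ε i a v = ε j b v') :
    ∃ η : VerticalForm π, ∀ i, η.pullback (k i) (h i) (w i) = ε i := by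
  -- `L` is required to match every part through `m` at once, so that a pointwise choice of
  -- functionals is already compatible with all parts.
  have key : ∀ m, ∃ L : VerticalSpace π m →ₗ[ℝ] ℝ, ∀ j b, k j b = m →
      ∀ (v' : VerticalSpace (ρ j) b) (v : VerticalSpace π m),
        (v.1 : M.E) = (diff (k j) b v'.1 : M.E) → L v = ε j b v' := by
    intro m
    obtain ⟨i, a, rfl⟩ := hs m
    let e := LinearEquiv.ofBijective _ (verticalDiff_bijective (hk i) (hh i) (w i) a)
    refine ⟨(ε i a).comp e.symm.toLinearMap, fun j b hb v' v hv => ?_⟩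
    refine hε i j a b hb.symm (e.symm v) v' (Eq.trans ?_ hv)
    exact congrArg Subtype.val (e.apply_symm_apply v)
  choose η hη using key
  refine ⟨η, fun i => VerticalForm.ext fun a v => hη _ i a rfl v _ rfl⟩

/-- A local extension `θ` on a part is carried to `M` by pulling it back along a local inverse `s`
of `k i`. It still restricts to `η` because `ds ∘ d(k i)` is the identity. -/
theorem VerticalForm.isSmooth_of_cover
    (hk : ∀ i, IsOpenEmb (k i)) (hh : ∀ i, IsOpenEmb (h i)) (w : ∀ i, k i ≫ π = ρ i ≫ h i)
    (hs : ∀ m, ∃ i a, k i a = m) (η : VerticalForm π)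
    (hη : ∀ i, (η.pullback (k i) (h i) (w i)).IsSmooth) : η.IsSmooth := by
  intro m
  obtain ⟨i, a, rfl⟩ := hs m
  obtain ⟨W, θ, hW, ha, hθ, hηθ⟩ := hη i a
  have hd := (hk i).isLocalDiffeomorph a
  have hda : hd.localInverse (k i a) = a := hd.localInverse_left_inv hd.localInverse_mem_target
  set s : M → A i := hd.localInverse.toFun
  have hsm : ContMDiffOn M.model (A i).model ∞ s hd.localInverse.source :=
    hd.localInverse_contMDiffOn
  refine ⟨hd.localInverse.source ∩ s ⁻¹' W, fun q => (θ (s q)).comp (mfderiv M.model (A i).model s q),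
    hsm.continuousOn.isOpen_inter_preimage hd.localInverse_open_source hW,
    ⟨hd.localInverse_mem_source, by rw [mem_preimage, hda]; exact ha⟩,
    SmoothOneFormOn.pullback_of_contMDiffOn hW hθ hd.localInverse_open_source hsm, ?_⟩
  rintro q ⟨hq, hqW⟩ v
  obtain ⟨b, hb, rfl⟩ : ∃ b ∈ hd.localInverse.target, k i b = q :=
    ⟨s q, hd.localInverse.map_source hq, hd.localInverse_right_inv hq⟩
  have hsb : s (k i b) = b := hd.localInverse_left_inv hb
  obtain ⟨v, rfl⟩ := (verticalDiff_bijective (hk i) (hh i) (w i) b).2 v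
  have hbW : b ∈ W := by rw [← hsb]; exact hqW
  refine (hηθ b hbW v).trans ?_
  have h1 : mfderiv (A i).model (A i).model (s ∘ k i) b =
      (mfderiv M.model (A i).model s (k i b)).comp (diff (k i) b) :=
    mfderiv_comp b ((hsm.contMDiffAt (hd.localInverse_open_source.mem_nhds hq)).mdifferentiableAt
      (by simp)) (mdiff (k i) b)
  have h2 : s ∘ k i =ᶠ[nhds b] id :=
    Filter.eventuallyEq_of_mem (hd.localInverse.open_target.mem_nhds hb)
      hd.localInverse_eqOn_left
  have h3 : (mfderiv M.model (A i).model s (k i b) (diff (k i) b v.1) : (A i).E) = (v.1 : (A i).E) := by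
    have h4 := congrArg (fun L => (L v.1 : (A i).E)) h1
    have h5 : (mfderiv (A i).model (A i).model (s ∘ k i) b v.1 : (A i).E) = (v.1 : (A i).E) := by
      rw [h2.mfderiv_eq, mfderiv_id]
      rfl
    exact h4.symm.trans h5
  -- The points `s (k i b)` and `b` are only propositionally equal; `h6` transports `θ` between
  -- their tangent spaces.
  have h6 : ∀ (b' : A i) (_ : b' = b) (x : TangentSpace (A i).model b')
      (y : TangentSpace (A i).model b), (x : (A i).E) = (y : (A i).E) → θ b y = θ b' x := by
    rintro _ rfl x y hxy
    exact congrArg _ hxy.symm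
  exact h6 _ hsb _ _ h3

theorem VerticalForm.isNondegenerate_of_cover
    (hk : ∀ i, IsOpenEmb (k i)) (hh : ∀ i, IsOpenEmb (h i)) (w : ∀ i, k i ≫ π = ρ i ≫ h i)
    (hs : ∀ m, ∃ i a, k i a = m) (η : VerticalForm π)
    (hη : ∀ i, (η.pullback (k i) (h i) (w i)).IsNondegenerate) : η.IsNondegenerate := by
  intro m v hv
  obtain ⟨i, a, rfl⟩ := hs m
  obtain ⟨v, rfl⟩ := (verticalDiff_bijective (hk i) (hh i) (w i) a).2 v
  rw [hη i a v hv, map_zero]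

end Forms

/-! ### Gluing of interval bundles -/

section IntervalBundle

/-- The product of a manifold with the real line. -/
def prodLine (U : Man.{u}) : Man.{u} where
  carrier := U × (⊤ : Opens ℝ)
  E := U.E × ℝ
  H := ModelProd U.H ℝ
  model := U.model.prod 𝓘(ℝ, ℝ)

/-- An interval bundle over an open subset `V` of `U` has local trivializations with values in
`U × ℝ`. -/
theorem IsIntervalBundle.exists_chart {U M : Man.{u}} {V : Opens U} {π : M ⟶ ofOpens V}
    (hπ : IsIntervalBundle π) (x : ofOpens V) :
    ∃ (W : Opens U) (e : OpenPartialHomeomorph M (prodLine U)), x.1 ∈ W ∧ (W : Set U) ⊆ V ∧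
      e.source = (π ≫ ofOpensι V) ⁻¹' W ∧ e.target = (W : Set U) ×ˢ (univ : Set (⊤ : Opens ℝ)) ∧
      (∀ m ∈ e.source, (e m).1 = (π m).1) ∧
      ContMDiffOn M.model (prodLine U).model ∞ e e.source ∧
      ContMDiffOn (prodLine U).model M.model ∞ e.symm e.target := by
  obtain ⟨I, hne, hI, hπI⟩ := hπ
  -- The diffeomorphism `ψ` replaces the individual typical fibre by the line, which makes the
  -- target independent of the bundle.
  obtain ⟨ψ⟩ := nonempty_diffeomorph_interval hne hI
  obtain ⟨e, hx, he⟩ := hπI x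
  have : Nonempty V := ⟨x⟩
  set j := V.openPartialHomeomorphSubtypeCoe this
  have hjt : j.target = V := V.openPartialHomeomorphSubtypeCoe_target _
  have hjs : j.source = univ := V.openPartialHomeomorphSubtypeCoe_source _
  have hjl : ∀ y : V, j.symm y.1 = y := fun y => j.left_inv (by rw [hjs]; trivial)
  have hjsm : ContMDiffOn U.model U.model ∞ j.symm V := fun y hy => by
    refine ContMDiffAt.contMDiffWithinAt ?_
    refine (ContMDiffAt.subtypeVal_comp_iff (I := U.model) (I' := U.model) V j.symm y).1 ?_
    refine (contMDiffAt_id (I := U.model)).congr_of_eventuallyEq ?_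
    filter_upwards [V.isOpen.mem_nhds hy] with z hz
    exact j.right_inv (hjt.symm ▸ hz)
  let W : Opens U := ⟨Subtype.val '' e.baseSet, V.isOpen.isOpenMap_subtype_val _ e.open_baseSet⟩
  have hW : ∀ y : V, y.1 ∈ W ↔ y ∈ e.baseSet := fun y =>
    Subtype.val_injective.mem_set_image
  let c : OpenPartialHomeomorph M (prodLine U) :=
    e.toOpenPartialHomeomorph.trans (j.prod ψ.toHomeomorph.toOpenPartialHomeomorph)
  have hces : c.source = e.source := by
    exact Subset.antisymm (fun m hm => hm.1) fun m hm =>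
      ⟨hm, (hjs.symm ▸ trivial : (e m).1 ∈ j.source), trivial⟩
  have hcs : c.source = (π ≫ ofOpensι V) ⁻¹' W := by
    rw [hces, e.source_eq]
    ext m
    exact (hW (π m)).symm
  have hct : c.target = (W : Set U) ×ˢ (univ : Set (⊤ : Opens ℝ)) := by
    refine Subset.antisymm ?_ ?_
    · rintro ⟨y, t⟩ ⟨⟨hy, -⟩, hyt⟩
      exact ⟨⟨_, e.mem_target.1 hyt, j.right_inv hy⟩, trivial⟩
    · rintro ⟨_, t⟩ ⟨⟨y, hy, rfl⟩, -⟩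
      refine ⟨⟨hjt.symm ▸ y.2, trivial⟩, e.mem_target.2 ?_⟩
      change j.symm y.1 ∈ e.baseSet
      exact (hjl y).symm ▸ hy
  have hcV : ∀ y ∈ c.target, y.1 ∈ V ∧ j.symm y.1 ∈ e.baseSet := by
    intro y hy
    rw [hct] at hy
    obtain ⟨⟨y', hy', h⟩, -⟩ := hy
    rw [← h]
    exact ⟨y'.2, (hjl y').symm ▸ hy'⟩
  refine ⟨W, c, (hW x).2 hx, ?_, hcs, hct, ?_, ?_, ?_⟩
  · rintro _ ⟨y, -, rfl⟩
    exact y.2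
  · intro m hm
    exact congrArg Subtype.val (e.proj_toFun m (hces ▸ hm))
  · have h1 : ContMDiff (U.model.prod 𝓘(ℝ, ℝ)) (U.model.prod 𝓘(ℝ, ℝ)) ∞
        (Prod.map (Subtype.val : V → U) ψ) :=
      contMDiff_subtype_val.prodMap ψ.contMDiff
    rw [hces]
    exact h1.comp_contMDiffOn he.1
  · have h1 : ContMDiffOn (U.model.prod 𝓘(ℝ, ℝ)) (U.model.prod 𝓘(ℝ, ℝ)) ∞
        (Prod.map j.symm ψ.symm) ((V : Set U) ×ˢ (univ : Set (⊤ : Opens ℝ))) :=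
      hjsm.prodMap ψ.symm.contMDiff.contMDiffOn
    exact he.2.comp (h1.mono fun y hy => ⟨(hcV y hy).1, trivial⟩) fun y hy =>
      e.mem_target.2 (hcV y hy).2

/-- The typical fibres of the `ρ i` may differ, so the line is taken as common fibre and the charts
of `exists_chart` provide the trivializations. By `hr` a part contains the whole preimage of `V i`,
so such a chart is defined on the full preimage of `W`. -/
theorem isIntervalBundle_of_cover {U M : Man.{u}} {ι : Type w} {V : ι → Opens U}
    (hV : ∀ x, ∃ i, x ∈ V i) {A : ι → Man.{u}} {ρ : ∀ i, A i ⟶ ofOpens (V i)}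
    (hρ : ∀ i, IsIntervalBundle (ρ i)) {π : M ⟶ U} {k : ∀ i, A i ⟶ M} (hk : ∀ i, IsOpenEmb (k i))
    (w : ∀ i, k i ≫ π = ρ i ≫ ofOpensι (V i)) (hr : ∀ i, range (k i) = π ⁻¹' V i) :
    IsIntervalBundle π := by
  refine ⟨⊤, ⟨0, trivial⟩, ordConnected_univ, fun x => ?_⟩
  obtain ⟨i, hi⟩ := hV x
  obtain ⟨W, c, hxW, hWV, hcs, hct, hc1, hc, hc'⟩ := (hρ i).exists_chart ⟨x, hi⟩
  have : Nonempty (A i) := ⟨c.symm (x, ⟨0, trivial⟩)⟩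
  set κ := (hk i).isOpenEmbedding.toOpenPartialHomeomorph with hκ
  have hκl : ∀ b, κ.symm (k i b) = b := fun b => κ.left_inv (x := b) (by simp [hκ])
  have hκt : κ.target = range (k i) := by simp [hκ]
  have hwk : ∀ a, π (k i a) = (ρ i a).1 := fun a => congrArg (fun f : A i ⟶ U => f a) (w i)
  have hsm : ContMDiffOn M.model (A i).model ∞ κ.symm κ.target := by
    rw [hκt]
    rintro _ ⟨b, rfl⟩
    refine (((hk i).isLocalDiffeomorph b).contMDiffAt_of_comp (g := κ.symm)
      (contMDiffAt_id.congr_of_eventuallyEq (.of_forall hκl))).contMDiffWithinAt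
  have hmem : ∀ b, k i b ∈ (κ.symm.trans c).source ↔ (ρ i b).1 ∈ W := by
    intro b
    have h1 : k i b ∈ (κ.symm.trans c).source ↔ b ∈ c.source := by simp [hκl, hκt]
    rw [h1, hcs]
    rfl
  have hsrc : (κ.symm.trans c).source ⊆ range (k i) := fun p hp => hκt ▸ hp.1
  have htgt : (κ.symm.trans c).target = c.target := by
    ext y
    simp [hκ]
  let T : Bundle.Trivialization (⊤ : Opens ℝ) π :=
    { κ.symm.trans c with
      baseSet := W
      open_baseSet := W.isOpen
      source_eq := by
        ext p
        constructor
        · intro hp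
          obtain ⟨b, rfl⟩ := hsrc hp
          change π (k i b) ∈ W
          rw [hwk]
          exact (hmem b).1 hp
        · intro hp
          have hp' : π p ∈ W := hp
          obtain ⟨b, rfl⟩ : p ∈ range (k i) := by
            rw [hr]
            exact hWV hp
          rw [hwk] at hp'
          exact (hmem b).2 hp'
      target_eq := htgt.trans hct
      proj_toFun := by
        intro p hp
        obtain ⟨b, rfl⟩ := hsrc hp
        change (c (κ.symm (k i b))).1 = π (k i b)
        have hb : κ.symm (k i b) ∈ c.source := hp.2
        rw [hκl] at hb
        rw [hκl, hwk, hc1 b hb] }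
  refine ⟨T, hxW, ?_, ?_⟩
  · exact hc.comp (hsm.mono inter_subset_left) fun p hp => hp.2
  · refine ((k i).smooth.comp_contMDiffOn hc').mono ?_
    exact htgt.subset

end IntervalBundle

/-! ### Descent data for families -/

section Descent

open Pseudofunctor Pseudofunctor.LocallyDiscreteOpToCat

/-- A smooth map with values in an open subset. -/
def toOpens {Q U : Man.{u}} (k : Q ⟶ U) (W : Opens U) (hk : ∀ q, k q ∈ W) : Q ⟶ ofOpens W where
  toFun q := ⟨k q, hk q⟩
  smooth := (ContMDiff.subtypeVal_comp_iff (I := Q.model) (I' := U.model) W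
    (fun q : Q => (⟨k q, hk q⟩ : W))).1 k.smooth

/-- The inclusion of an open subset into a larger one. -/
def opensMap {U : Man.{u}} {V W : Opens U} (h : V ≤ W) : ofOpens V ⟶ ofOpens W :=
  toOpens (ofOpensι V) W fun x => h x.2

/-- Locally `f` is `f ≫ g` followed by a local inverse of `g`. -/
theorem _root_.SmoothLoc.Man.IsOpenEmb.of_comp {M N Q : Man.{u}} {f : M ⟶ N} {g : N ⟶ Q}
    (hg : IsOpenEmb g) (hfg : IsOpenEmb (f ≫ g)) : IsOpenEmb f := by
  refine .of_injective (fun x => ?_) fun x y hxy =>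
    hfg.isOpenEmbedding.injective (congrArg g hxy)
  have h := hg.isLocalDiffeomorph (f x)
  have h1 : IsLocalDiffeomorphAt M.model N.model ∞ (h.localInverse ∘ (f ≫ g)) x :=
    (hfg.isLocalDiffeomorph x).comp (K := N.model) (P := N) h.localInverse_isLocalDiffeomorphAt
  refine h1.congr_of_eventuallyEq ?_
  filter_upwards [f.smooth.continuous.continuousAt h.localInverse_eventuallyEq_left] with y hy
  exact hy.symm

theorem isOpenEmb_opensMap {U : Man.{u}} {V W : Opens U} (h : V ≤ W) : IsOpenEmb (opensMap h) :=
  (isOpenEmb_ofOpensι W).of_comp (isOpenEmb_ofOpensι V)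

variable {U : Man.{u}}

theorem Family.Hom.proj_map {X Y : Family U} (f : X ⟶ Y) (m : X.total) :
    Y.proj (f.map m) = X.proj m :=
  congrArg (fun k : X.total ⟶ U => k m) f.w

theorem Family.Hom.fst_map {U' U'' : Man.{u}} {h : U ⟶ U'} {h' : U ⟶ U''} {X : Family U'}
    {Y : Family U''} (f : X.pullbackObj h ⟶ Y.pullbackObj h') (p : (X.pullbackObj h).total) :
    PullbackCarrier.fst (f.map p) = PullbackCarrier.fst p :=
  f.proj_map p

/-- `mapComp'` carries an equation between morphisms; once this is substituted it is the coherence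
isomorphism `pullbackComp`, which leaves the point of `X.total` in place. -/
theorem loc_mapComp'_hom {Y Y' : Man.{u}} (f : Y ⟶ U) (g : Y' ⟶ Y) (gf : Y' ⟶ U)
    (h : g ≫ f = gf) (h' : f.op.toLoc ≫ g.op.toLoc = gf.op.toLoc) (X : Family U)
    (p : (X.pullbackObj gf).total) :
    PullbackCarrier.snd (PullbackCarrier.snd (Family.Hom.map (X := X.pullbackObj gf)
      (Y := (X.pullbackObj f).pullbackObj g)
      ((loc.mapComp' f.op.toLoc g.op.toLoc gf.op.toLoc h').hom.toNatTrans.app X) p)) =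
      PullbackCarrier.snd p := by
  subst h
  have h1 : loc.mapComp' f.op.toLoc g.op.toLoc (g ≫ f).op.toLoc h' =
      loc.mapComp f.op.toLoc g.op.toLoc := loc.mapComp'_eq_mapComp f.op.toLoc g.op.toLoc
  rw [h1]
  rfl

theorem loc_mapComp'_inv {Y Y' : Man.{u}} (f : Y ⟶ U) (g : Y' ⟶ Y) (gf : Y' ⟶ U)
    (h : g ≫ f = gf) (h' : f.op.toLoc ≫ g.op.toLoc = gf.op.toLoc) (X : Family U)
    (p : ((X.pullbackObj f).pullbackObj g).total) :
    PullbackCarrier.snd (Family.Hom.map (X := (X.pullbackObj f).pullbackObj g)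
      (Y := X.pullbackObj gf)
      ((loc.mapComp' f.op.toLoc g.op.toLoc gf.op.toLoc h').inv.toNatTrans.app X) p) =
      PullbackCarrier.snd (PullbackCarrier.snd p) := by
  subst h
  have h1 : loc.mapComp' f.op.toLoc g.op.toLoc (g ≫ f).op.toLoc h' =
      loc.mapComp f.op.toLoc g.op.toLoc := loc.mapComp'_eq_mapComp f.op.toLoc g.op.toLoc
  rw [h1]
  rfl

/-- `pullHom` is the pullback of `φ` along `g`, conjugated by coherence isomorphisms. As these do
not move points of the total spaces, the restriction acts as `φ` at the base point `g p.fst`. -/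
theorem snd_map_pullHom {U₁ U₂ Y Y' : Man.{u}} {X₁ : Family U₁} {X₂ : Family U₂} {f₁ : Y ⟶ U₁}
    {f₂ : Y ⟶ U₂} (φ : X₁.pullbackObj f₁ ⟶ X₂.pullbackObj f₂) (g : Y' ⟶ Y) (gf₁ : Y' ⟶ U₁)
    (gf₂ : Y' ⟶ U₂) (h₁ : g ≫ f₁ = gf₁) (h₂ : g ≫ f₂ = gf₂)
    (p : (X₁.pullbackObj gf₁).total) :
    PullbackCarrier.snd (Family.Hom.map (X := X₁.pullbackObj gf₁) (Y := X₂.pullbackObj gf₂)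
      (pullHom (F := loc) (M₁ := X₁) (M₂ := X₂) (f₁ := f₁) (f₂ := f₂) φ g gf₁ gf₂ h₁ h₂) p) =
      PullbackCarrier.snd (φ.map (⟨g p.fst, p.snd,
        (congrArg (fun k : Y' ⟶ U₁ => k (PullbackCarrier.fst p)) h₁).trans p.w⟩ : PullbackCarrier f₁ X₁.proj)) := by
  refine (loc_mapComp'_inv f₂ g gf₂ h₂ (congrArg (fun k => k.op.toLoc) h₂) X₂ _).trans ?_
  refine congrArg (fun q => PullbackCarrier.snd (φ.map q)) (PullbackCarrier.ext ?_ ?_)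
  · exact (PullbackCarrier.w _).symm.trans (congrArg g (Family.Hom.proj_map
      (X := X₁.pullbackObj gf₁) (Y := (X₁.pullbackObj f₁).pullbackObj g)
      ((loc.mapComp' f₁.op.toLoc g.op.toLoc gf₁.op.toLoc
        (congrArg (fun k => k.op.toLoc) h₁)).hom.toNatTrans.app X₁) p))
  · exact loc_mapComp'_hom f₁ g gf₁ h₁ (congrArg (fun k => k.op.toLoc) h₁) X₁ p

variable {ι : Type w} {A : ι → Man.{u}} {f : ∀ i, A i ⟶ U}

/-- The transition maps of the descent datum of a family consist of coherence isomorphisms only. -/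
theorem snd_snd_map_ofObj_hom (X : Family U) {Y : Man.{u}} (q : Y ⟶ U) {i j : ι} (f₁ : Y ⟶ A i)
    (f₂ : Y ⟶ A j) (h₁ : f₁ ≫ f i = q) (h₂ : f₂ ≫ f j = q)
    (p : ((X.pullbackObj (f i)).pullbackObj f₁).total) :
    PullbackCarrier.snd (PullbackCarrier.snd (Family.Hom.map
      (X := (X.pullbackObj (f i)).pullbackObj f₁) (Y := (X.pullbackObj (f j)).pullbackObj f₂)
      ((DescentData.ofObj (F := loc) (f := f) X).hom q f₁ f₂ h₁ h₂) p)) =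
      PullbackCarrier.snd (PullbackCarrier.snd p) :=
  (loc_mapComp'_hom (f j) f₂ q h₂ (congrArg (fun k => k.op.toLoc) h₂) X _).trans (loc_mapComp'_inv (f i) f₁ q h₁ _ X p)

/-! #### Transition maps of a descent datum -/

variable (D : loc.{u}.DescentData f)

/-- The family over `A i` of a descent datum. -/
def descentObj (i : ι) : Family (A i) := D.obj i

/-- The transition morphisms of a descent datum. -/
def descentHom {Y : Man.{u}} (q : Y ⟶ U) {i j : ι} (f₁ : Y ⟶ A i) (f₂ : Y ⟶ A j)
    (h₁ : f₁ ≫ f i = q) (h₂ : f₂ ≫ f j = q) :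
    (descentObj D i).pullbackObj f₁ ⟶ (descentObj D j).pullbackObj f₂ :=
  D.hom q f₁ f₂ h₁ h₂

theorem descentHom_self {Y : Man.{u}} (q : Y ⟶ U) {i : ι} (g : Y ⟶ A i) (h : g ≫ f i = q)
    (p : ((descentObj D i).pullbackObj g).total) : (descentHom D q g g h h).map p = p :=
  congrArg (fun k : (descentObj D i).pullbackObj g ⟶ (descentObj D i).pullbackObj g => k.map p)
    (D.hom_self q g h)

theorem descentHom_comp {Y : Man.{u}} (q : Y ⟶ U) {i j k : ι} (f₁ : Y ⟶ A i) (f₂ : Y ⟶ A j)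
    (f₃ : Y ⟶ A k) (h₁ : f₁ ≫ f i = q) (h₂ : f₂ ≫ f j = q) (h₃ : f₃ ≫ f k = q)
    (p : ((descentObj D i).pullbackObj f₁).total) :
    (descentHom D q f₂ f₃ h₂ h₃).map ((descentHom D q f₁ f₂ h₁ h₂).map p) =
      (descentHom D q f₁ f₃ h₁ h₃).map p :=
  congrArg (fun l : (descentObj D i).pullbackObj f₁ ⟶ (descentObj D k).pullbackObj f₃ => l.map p)
    (D.hom_comp q f₁ f₂ f₃ h₁ h₂ h₃)

/-- This is `pullHom_hom` on points: it compares a transition map over an arbitrary `Y'` with one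
over a `Y` through which it factors, in practice `V i ⊓ V j`. The point `p'` is left free so that
any representative of the image of `p` can be used. -/
theorem descentHom_naturality {Y Y' : Man.{u}} (g : Y' ⟶ Y) (q : Y ⟶ U) (q' : Y' ⟶ U)
    (hq : g ≫ q = q') {i j : ι} (f₁ : Y ⟶ A i) (f₂ : Y ⟶ A j) (h₁ : f₁ ≫ f i = q)
    (h₂ : f₂ ≫ f j = q) (gf₁ : Y' ⟶ A i) (gf₂ : Y' ⟶ A j) (hg₁ : g ≫ f₁ = gf₁)
    (hg₂ : g ≫ f₂ = gf₂) (h₁' : gf₁ ≫ f i = q') (h₂' : gf₂ ≫ f j = q')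
    (p : ((descentObj D i).pullbackObj gf₁).total)
    (p' : ((descentObj D i).pullbackObj f₁).total)
    (hp₁ : PullbackCarrier.fst p' = g (PullbackCarrier.fst p))
    (hp₂ : PullbackCarrier.snd p' = PullbackCarrier.snd p) :
    PullbackCarrier.snd ((descentHom D q' gf₁ gf₂ h₁' h₂').map p) =
      PullbackCarrier.snd ((descentHom D q f₁ f₂ h₁ h₂).map p') := by
  have h := congrArg (fun k : (descentObj D i).pullbackObj gf₁ ⟶ (descentObj D j).pullbackObj gf₂ =>
    PullbackCarrier.snd (k.map p)) (D.pullHom_hom g q q' hq f₁ f₂ h₁ h₂ gf₁ gf₂ hg₁ hg₂)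
  refine h.symm.trans ((snd_map_pullHom (X₁ := descentObj D i) (X₂ := descentObj D j)
    (descentHom D q f₁ f₂ h₁ h₂) g gf₁ gf₂ hg₁ hg₂ p).trans ?_)
  exact congrArg (fun r => PullbackCarrier.snd ((descentHom D q f₁ f₂ h₁ h₂).map r))
    (PullbackCarrier.ext hp₁.symm hp₂.symm)

end Descent

/-! ### Descent for families -/

section Gluing

open Pseudofunctor

variable {U : Man.{u}} {ι : Type w} {V : ι → Opens U}
  (D : loc.{u}.DescentData fun i => ofOpensι (V i))

/-- The transition morphism over an intersection `V i ⊓ V j`. -/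
abbrev transition (i j : ι) :
    (descentObj D i).pullbackObj (opensMap (inf_le_left : V i ⊓ V j ≤ V i)) ⟶
      (descentObj D j).pullbackObj (opensMap (inf_le_right : V i ⊓ V j ≤ V j)) :=
  descentHom D (ofOpensι (V i ⊓ V j)) _ _ rfl rfl

/-- The relation on points of the parts given by the transition morphisms. -/
def DescentRel (i j : ι) (a : (descentObj D i).total) (b : (descentObj D j).total) : Prop :=
  ∃ p : ((descentObj D i).pullbackObj (opensMap (inf_le_left : V i ⊓ V j ≤ V i))).total,
    PullbackCarrier.snd p = a ∧ PullbackCarrier.snd ((transition D i j).map p) = b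

variable {D}

/-- A manifold mapping compatibly to `V i` and `V j` maps to `V i ⊓ V j`, so by naturality every
transition map of the datum induces the same relation. The equivalence relation axioms can thus be
checked over any convenient manifold. -/
theorem descentRel_descentHom {Y : Man.{u}} (q : Y ⟶ U) {i j : ι} (f₁ : Y ⟶ ofOpens (V i))
    (f₂ : Y ⟶ ofOpens (V j)) (h₁ : f₁ ≫ ofOpensι (V i) = q) (h₂ : f₂ ≫ ofOpensι (V j) = q)
    (p : ((descentObj D i).pullbackObj f₁).total) :
    DescentRel D i j (PullbackCarrier.snd p)
      (PullbackCarrier.snd ((descentHom D q f₁ f₂ h₁ h₂).map p)) := by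
  have e₁ : ∀ y, (f₁ y).1 = q y := fun y => congrArg (fun k : Y ⟶ U => k y) h₁
  have e₂ : ∀ y, (f₂ y).1 = q y := fun y => congrArg (fun k : Y ⟶ U => k y) h₂
  let g : Y ⟶ ofOpens (V i ⊓ V j) :=
    toOpens q (V i ⊓ V j) fun y => ⟨e₁ y ▸ (f₁ y).2, e₂ y ▸ (f₂ y).2⟩
  have hg₁ : g ≫ opensMap (inf_le_left : V i ⊓ V j ≤ V i) = f₁ :=
    Man.hom_ext fun y => Subtype.ext (e₁ y).symm
  have hg₂ : g ≫ opensMap (inf_le_right : V i ⊓ V j ≤ V j) = f₂ :=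
    Man.hom_ext fun y => Subtype.ext (e₂ y).symm
  refine ⟨(⟨g p.fst, p.snd, (congrArg (fun k : Y ⟶ ofOpens (V i) => k (PullbackCarrier.fst p))
    hg₁).trans p.w⟩ : PullbackCarrier _ _), rfl, ?_⟩
  exact (descentHom_naturality D g (ofOpensι (V i ⊓ V j)) q rfl _ _ rfl rfl f₁ f₂ hg₁ hg₂ h₁ h₂ p
    _ rfl rfl).symm

theorem DescentRel.proj_eq {i j : ι} {a : (descentObj D i).total} {b : (descentObj D j).total}
    (h : DescentRel D i j a b) : ((descentObj D i).proj a).1 = ((descentObj D j).proj b).1 := by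
  obtain ⟨p, rfl, rfl⟩ := h
  have h1 := congrArg Subtype.val (PullbackCarrier.w p)
  have h2 := congrArg Subtype.val (PullbackCarrier.w ((transition D i j).map p))
  have h3 := congrArg Subtype.val (Family.Hom.fst_map (transition D i j) p)
  exact h1.symm.trans (h3.symm.trans h2)

/-- The point `a` determines the point of the overlap above it, since the projection from the
pullback over `V i ⊓ V j` is injective. -/
theorem DescentRel.unique {i j : ι} {a : (descentObj D i).total} {b b' : (descentObj D j).total}
    (h : DescentRel D i j a b) (h' : DescentRel D i j a b') : b = b' := by
  obtain ⟨p, hp, rfl⟩ := h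
  obtain ⟨p', hp', rfl⟩ := h'
  rw [(isOpenEmb_pullbackSnd _ (isOpenEmb_opensMap _)
    (descentObj D i).isIntervalBundle).isOpenEmbedding.injective (hp.trans hp'.symm)]

theorem exists_descentRel {i j : ι} (a : (descentObj D i).total)
    (ha : ((descentObj D i).proj a).1 ∈ V j) : ∃ b, DescentRel D i j a b :=
  ⟨_, (⟨⟨((descentObj D i).proj a).1, ((descentObj D i).proj a).2, ha⟩, a, rfl⟩ :
    PullbackCarrier (opensMap (inf_le_left : V i ⊓ V j ≤ V i)) (descentObj D i).proj), rfl, rfl⟩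

theorem DescentRel.congr_right {i j : ι} {a : (descentObj D i).total}
    {b b' : (descentObj D j).total} (h : DescentRel D i j a b) (e : b = b') :
    DescentRel D i j a b' :=
  e ▸ h

theorem DescentRel.refl {i : ι} (a : (descentObj D i).total) : DescentRel D i i a a := by
  have h := descentRel_descentHom (D := D) (ofOpensι (V i)) (𝟙 _) (𝟙 _) rfl rfl
    (⟨(descentObj D i).proj a, a, rfl⟩ : PullbackCarrier (𝟙 (ofOpens (V i))) (descentObj D i).proj)
  exact h.congr_right (congrArg PullbackCarrier.snd (descentHom_self D _ _ _ _))

theorem DescentRel.symm {i j : ι} {a : (descentObj D i).total} {b : (descentObj D j).total}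
    (h : DescentRel D i j a b) : DescentRel D j i b a := by
  obtain ⟨p, rfl, rfl⟩ := h
  have h := descentRel_descentHom (D := D) (ofOpensι (V i ⊓ V j)) (opensMap inf_le_right)
    (opensMap inf_le_left) rfl rfl ((transition D i j).map p)
  exact h.congr_right (congrArg PullbackCarrier.snd
    -- Going from `i` to `j` and back is the transition map from `i` to itself, hence the identity.
    ((descentHom_comp D _ _ _ _ _ _ _ _).trans (descentHom_self D _ _ _ _)))

theorem DescentRel.trans {i j k : ι} {a : (descentObj D i).total} {b : (descentObj D j).total}
    {c : (descentObj D k).total} (h : DescentRel D i j a b) (h' : DescentRel D j k b c) :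
    DescentRel D i k a c := by
  let W : Opens U := V i ⊓ (V j ⊓ V k)
  -- The related points `a`, `b`, `c` have the same projection, so it lies in the triple
  -- intersection, where the cocycle condition applies.
  let x : ofOpens W := ⟨((descentObj D i).proj a).1, ((descentObj D i).proj a).2,
    h.proj_eq ▸ ((descentObj D j).proj b).2,
    (h.proj_eq.trans h'.proj_eq) ▸ ((descentObj D k).proj c).2⟩
  let f₁ : ofOpens W ⟶ ofOpens (V i) := opensMap inf_le_left
  let f₂ : ofOpens W ⟶ ofOpens (V j) := opensMap (inf_le_right.trans inf_le_left)
  let f₃ : ofOpens W ⟶ ofOpens (V k) := opensMap (inf_le_right.trans inf_le_right)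
  let p : ((descentObj D i).pullbackObj f₁).total := (⟨x, a, rfl⟩ : PullbackCarrier _ _)
  have h₁ := h.unique (descentRel_descentHom (ofOpensι W) f₁ f₂ rfl rfl p)
  have h₂ := descentRel_descentHom (ofOpensι W) f₂ f₃ rfl rfl
    ((descentHom D (ofOpensι W) f₁ f₂ rfl rfl).map p)
  exact (descentRel_descentHom (ofOpensι W) f₁ f₃ rfl rfl p).congr_right
    ((congrArg PullbackCarrier.snd (descentHom_comp D _ _ _ _ _ _ _ _)).symm.trans
      (h'.unique ((congrArg (fun y => DescentRel D j k y _) h₁).mpr h₂)).symm)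

variable (D)

/-- The equivalence relation on the disjoint union of the parts. -/
def descentSetoid : Setoid (Σ i, (descentObj D i).total) where
  r p q := DescentRel D p.1 q.1 p.2 q.2
  iseqv := ⟨fun p => .refl p.2, fun h => h.symm, fun h h' => h.trans h'⟩

/-- The index type may lie in a larger universe than the manifolds. Choosing one index `c x` for
each point `x` of `U` already reaches every class, because any point is related to one in the part
indexed by its projection. -/
theorem small_descentQuotient (hV : ∀ x, ∃ i, x ∈ V i) :
    Small.{u} (Quotient (descentSetoid D)) := by
  choose c hc using hV
  refine small_of_surjective (α := Σ x : U, (descentObj D (c x)).total)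
    (f := fun p => Quotient.mk _ ⟨c p.1, p.2⟩) fun q => ?_
  obtain ⟨⟨i, a⟩, rfl⟩ := Quotient.exists_rep q
  obtain ⟨b, hb⟩ := exists_descentRel (D := D) (j := c ((descentObj D i).proj a).1) a (hc _)
  exact ⟨⟨_, b⟩, Quotient.sound hb.symm⟩

section

variable [Small.{u} (Quotient (descentSetoid D))]

/-- The gluing data for the total space. -/
def descentGluing : ManGluing.{u} ι where
  part i := (descentObj D i).total
  carrier := Shrink.{u} (Quotient (descentSetoid D))
  incl i a := equivShrink _ (Quotient.mk _ ⟨i, a⟩)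
  -- Related points of the same part coincide: the relation is functional and contains the diagonal.
  incl_injective i a b h :=
    (DescentRel.refl a).unique (Quotient.exact ((equivShrink _).injective h))
  incl_surjective p := by
    obtain ⟨⟨i, a⟩, h⟩ := Quotient.exists_rep ((equivShrink _).symm p)
    exact ⟨i, a, by rw [h, Equiv.apply_symm_apply]⟩
  overlap i j := ((descentObj D i).pullbackObj (opensMap (inf_le_left : V i ⊓ V j ≤ V i))).total
  left i j := pullbackSnd _ (descentObj D i).isIntervalBundle
  right i j := (transition D i j).map ≫ pullbackSnd _ (descentObj D j).isIntervalBundle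
  isOpenEmb_left i j := isOpenEmb_pullbackSnd _ (isOpenEmb_opensMap _) _
  isOpenEmb_right i j :=
    (transition D i j).isOpenEmb.comp (isOpenEmb_pullbackSnd _ (isOpenEmb_opensMap _) _)
  incl_eq_iff i j a b :=
    ⟨fun h => Quotient.exact ((equivShrink _).injective h),
      fun h => congrArg _ (Quotient.sound h)⟩
  model := prodLine U
  exists_chart i a := by
    obtain ⟨W, e, hx, -, hs, -, -, he, he'⟩ :=
      (descentObj D i).isIntervalBundle.exists_chart ((descentObj D i).proj a)
    exact ⟨e, hs ▸ hx, he, he'⟩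

/-- The projection of the glued space. -/
def descentProj (p : (descentGluing D).carrier) : U :=
  Quotient.lift (fun a : Σ i, (descentObj D i).total => ((descentObj D a.1).proj a.2).1)
    (fun _ _ h => DescentRel.proj_eq h) ((equivShrink _).symm p)

theorem descentProj_incl (i : ι) (a : (descentObj D i).total) :
    descentProj D ((descentGluing D).incl i a) = ((descentObj D i).proj a).1 := by
  change Quotient.lift _ _ ((equivShrink _).symm (equivShrink _ _)) = _
  rw [Equiv.symm_apply_apply]
  rfl

theorem range_descentGluing_incl (i : ι) :
    range ((descentGluing D).incl i) = descentProj D ⁻¹' V i := by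
  ext p
  constructor
  · rintro ⟨a, rfl⟩
    exact (congrArg (fun y => y ∈ V i) (descentProj_incl D i a)).mpr ((descentObj D i).proj a).2
  · intro hp
    obtain ⟨j, b, rfl⟩ := (descentGluing D).incl_surjective p
    obtain ⟨a, ha⟩ := exists_descentRel b
      ((congrArg (fun y => y ∈ V i) (descentProj_incl D j b)).mp hp)
    exact ⟨a, ((descentGluing D).incl_eq_iff _ _ _ _).2 ha.symm⟩

theorem continuous_descentProj : Continuous (descentProj D) := by
  refine (descentGluing D).continuous_iff.2 fun i => ?_
  rw [show descentProj D ∘ (descentGluing D).incl i = (descentObj D i).proj ≫ ofOpensι (V i) from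
    funext fun a => descentProj_incl D i a]
  exact ((descentObj D i).proj ≫ ofOpensι (V i)).smooth.continuous

end

/-- A descent datum can be glued to a family. -/
theorem exists_descentGlue (hV : ∀ x, ∃ i, x ∈ V i) :
    ∃ (G : Family U) (k : ∀ i, (descentObj D i).total ⟶ G.total)
      (w : ∀ i, k i ≫ G.proj = (descentObj D i).proj ≫ ofOpensι (V i)),
      (∀ i, IsOpenEmb (k i)) ∧ (∀ i, range (k i) = G.proj ⁻¹' V i) ∧
      (∀ i, G.form.pullback (k i) (ofOpensι (V i)) (w i) = (descentObj D i).form) ∧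
      ∀ i j a b, k i a = k j b ↔ DescentRel D i j a b := by
  have := small_descentQuotient D hV
  have hr := range_descentGluing_incl D
  have := (descentGluing D).t2Space (continuous_descentProj D) hr
  have := (descentGluing D).secondCountableTopology hr
  let M := (descentGluing D).total
  let k : ∀ i, (descentObj D i).total ⟶ M := (descentGluing D).inclHom
  have hk : ∀ i, IsOpenEmb (k i) := (descentGluing D).isOpenEmb_inclHom
  have hs : ∀ m : M, ∃ i a, k i a = m := (descentGluing D).incl_surjective
  have hkr : ∀ i j a b, k i a = k j b ↔ DescentRel D i j a b := (descentGluing D).incl_eq_iff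
  obtain ⟨π, w⟩ := exists_glue k hk hs (fun i => (descentObj D i).proj ≫ ofOpensι (V i))
    fun i j a b h => ((hkr i j a b).1 h).proj_eq
  have hπ : ∀ m : M, π m = descentProj D m := by
    intro m
    obtain ⟨i, a, rfl⟩ := hs m
    exact (congrArg (fun f : (descentObj D i).total ⟶ U => f a) (w i)).trans
      (descentProj_incl D i a).symm
  have hr' : ∀ i, range (k i) = π ⁻¹' V i := fun i => (hr i).trans
    (Set.ext fun m => iff_of_eq (congrArg (fun y => y ∈ V i) (hπ m).symm))
  have hι : ∀ i, IsOpenEmb (ofOpensι (V i)) := fun i => isOpenEmb_ofOpensι (V i)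
  obtain ⟨η, hη⟩ := VerticalForm.exists_glue hk hι w hs (fun i => (descentObj D i).form) (by
    intro i j a b hab v v' hv
    obtain ⟨p, rfl, rfl⟩ := (hkr i j a b).1 hab
    let P := (descentObj D i).pullbackObj (opensMap (inf_le_left : V i ⊓ V j ≤ V i))
    have wr : ((transition D i j).map ≫
        pullbackSnd (opensMap (inf_le_right : V i ⊓ V j ≤ V j)) (descentObj D j).isIntervalBundle) ≫
        (descentObj D j).proj = P.proj ≫ opensMap (inf_le_right : V i ⊓ V j ≤ V j) :=
      Man.hom_ext fun q => (PullbackCarrier.w ((transition D i j).map q)).symm.trans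
        (congrArg _ (Family.Hom.fst_map (transition D i j) q))
    -- The forms agree on the overlap because the transition morphism preserves the pulled back
    -- forms.
    refine VerticalForm.apply_eq_of_overlap (descentObj D i).form (descentObj D j).form
      (k := k i) (k' := k j) (hk j) (τ := P.proj)
      (l := pullbackSnd _ (descentObj D i).isIntervalBundle)
      (isOpenEmb_pullbackSnd _ (isOpenEmb_opensMap _) _)
      (isOpenEmb_opensMap (inf_le_left : V i ⊓ V j ≤ V i))
      (pullback_condition _ _) wr ?_ ?_ p v v' hv
    · exact Man.hom_ext fun q => (hkr _ _ _ _).2 ⟨q, rfl, rfl⟩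
    · refine (transition D i j).preserves.symm.trans ?_
      exact VerticalForm.pullback_pullback _ _ _ _ _ _ _ wr rfl)
  exact ⟨⟨M, π, isIntervalBundle_of_cover hV (fun i => (descentObj D i).isIntervalBundle) hk w hr',
    η, VerticalForm.isSmooth_of_cover hk hι w hs η fun i => by
      rw [hη]; exact (descentObj D i).isSmooth,
    VerticalForm.isNondegenerate_of_cover hk hι w hs η fun i => by
      rw [hη]; exact (descentObj D i).isNondegenerate⟩, k, w, hk, hr', hη, hkr⟩

end Gluing

/-! ### The canonical functor to descent data is an equivalence -/

section Stack

open Pseudofunctor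

variable {U : Man.{u}} {ι : Type w} {V : ι → Opens U}

theorem pullbackObj_hom_ext {U₁ U₂ Y : Man.{u}} {X₁ : Family U₁} {X₂ : Family U₂} {f₁ : Y ⟶ U₁}
    {f₂ : Y ⟶ U₂} {φ ψ : X₁.pullbackObj f₁ ⟶ X₂.pullbackObj f₂}
    (h : ∀ p, PullbackCarrier.snd (φ.map p) = PullbackCarrier.snd (ψ.map p)) : φ = ψ :=
  Family.hom_ext (Man.hom_ext fun p =>
    PullbackCarrier.ext ((φ.fst_map p).trans (ψ.fst_map p).symm) (h p))

/-- An open embedding of families over `V ⊆ U`, with image the part over `V`, identifies the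
restriction to `V`. -/
theorem exists_iso_pullbackObj {W : Opens U} {G : Family U} {X : Family (ofOpens W)}
    (k : X.total ⟶ G.total) (w : k ≫ G.proj = X.proj ≫ ofOpensι W) (hk : IsOpenEmb k)
    (hr : range k = G.proj ⁻¹' W) (hf : G.form.pullback k (ofOpensι W) w = X.form) :
    ∃ e : G.pullbackObj (ofOpensι W) ≅ X, ∀ p, k (e.hom.map p) = PullbackCarrier.snd p := by
  let l : X.total ⟶ (G.pullbackObj (ofOpensι W)).total :=
    pullbackLift (ofOpensι W) G.isIntervalBundle X.proj k w.symm
  -- Followed by the projection to `G.total`, `l` is the open embedding `k`, so `l` is one too; by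
  -- `hr` it is also surjective, hence a diffeomorphism.
  have hl : IsOpenEmb l :=
    (isOpenEmb_pullbackSnd _ (isOpenEmb_ofOpensι W) G.isIntervalBundle).of_comp hk
  have hls : Function.Surjective l := by
    intro p
    obtain ⟨a, ha⟩ : PullbackCarrier.snd p ∈ range k := by
      rw [hr]
      exact (congrArg (fun y => y ∈ W) p.w).mp (PullbackCarrier.fst p).2
    refine ⟨a, PullbackCarrier.ext (Subtype.ext ?_) ha⟩
    exact (congrArg (fun f : X.total ⟶ U => f a) w).symm.trans
      ((congrArg G.proj ha).trans p.w.symm)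
  obtain ⟨e, he⟩ := hl.exists_iso hls
  have w' : e.hom ≫ (G.pullbackObj (ofOpensι W)).proj = X.proj := by rw [he]; rfl
  refine ⟨(Family.isoMk e w' ?_).symm, fun p => ?_⟩
  · refine Eq.trans ?_ hf
    exact VerticalForm.pullback_pullback _ _ _ _ _ _ _ w
      (congrArg (fun t => t ≫ pullbackSnd (ofOpensι W) G.isIntervalBundle) he)
  · have h1 : e.hom (e.inv p) = p :=
      congrArg (fun f : (G.pullbackObj (ofOpensι W)).total ⟶ (G.pullbackObj (ofOpensι W)).total =>
        f p) e.inv_hom_id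
    rw [he] at h1
    exact congrArg PullbackCarrier.snd h1

theorem essSurj_toDescentData (hV : ∀ x, ∃ i, x ∈ V i) :
    (loc.{u}.toDescentData fun i => ofOpensι (V i)).EssSurj := by
  refine ⟨fun D => ?_⟩
  obtain ⟨G, k, w, hk, hr, hf, hrel⟩ := exists_descentGlue D hV
  choose e he using fun i => exists_iso_pullbackObj (k i) (w i) (hk i) (hr i) (hf i)
  refine ⟨G, ⟨DescentData.isoMk (D₁ := (loc.toDescentData fun i => ofOpensι (V i)).obj G) e ?_⟩⟩
  intro Y q i j f₁ f₂ h₁ h₂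
  -- Compatibility is tested in the glued space, after the injective map `k j`: both composites send
  -- `p` to its underlying point of `G.total`.
  refine pullbackObj_hom_ext (X₁ := G.pullbackObj (ofOpensι (V i))) (X₂ := descentObj D j)
    (f₁ := f₁) (f₂ := f₂) fun p => (hk j).isOpenEmbedding.injective ?_
  let p' : PullbackCarrier f₁ (descentObj D i).proj :=
    ⟨p.fst, (e i).hom.map p.snd, p.w.trans ((e i).hom.proj_map p.snd).symm⟩
  have h := (hrel _ _ _ _).2 (descentRel_descentHom (D := D) q f₁ f₂ h₁ h₂ p')
  exact h.symm.trans ((he i _).trans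
    ((snd_snd_map_ofObj_hom (f := fun i => ofOpensι (V i)) G q f₁ f₂ h₁ h₂ p).symm.trans
      (he j _).symm))

theorem faithful_toDescentData (hV : ∀ x, ∃ i, x ∈ V i) :
    (loc.{u}.toDescentData fun i => ofOpensι (V i)).Faithful := by
  refine ⟨fun {X Y} f g hfg => Family.hom_ext (Man.hom_ext fun m => ?_)⟩
  obtain ⟨i, hi⟩ := hV (Family.proj X m)
  have h := congrArg (fun k => DescentData.Hom.hom k i) hfg
  have h1 : (Family.pullbackFunctor (ofOpensι (V i))).map f =
    (Family.pullbackFunctor (ofOpensι (V i))).map g := h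
  exact congrArg (fun k : Family.pullbackObj (ofOpensι (V i)) X ⟶
    Family.pullbackObj (ofOpensι (V i)) Y => PullbackCarrier.snd (k.map
      (⟨⟨_, hi⟩, m, rfl⟩ : PullbackCarrier (ofOpensι (V i)) (Family.proj X)))) h1

/-- Compatible morphisms between the restrictions of two families glue. -/
theorem exists_family_glue (hV : ∀ x, ∃ i, x ∈ V i) {X Y : Family U}
    (α : ∀ i, X.pullbackObj (ofOpensι (V i)) ⟶ Y.pullbackObj (ofOpensι (V i)))
    (hα : ∀ i j (a : (X.pullbackObj (ofOpensι (V i))).total)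
      (b : (X.pullbackObj (ofOpensι (V j))).total),
      PullbackCarrier.snd a = PullbackCarrier.snd b →
        PullbackCarrier.snd ((α i).map a) = PullbackCarrier.snd ((α j).map b)) :
    ∃ φ : X ⟶ Y, ∀ i, (Family.pullbackFunctor (ofOpensι (V i))).map φ = α i := by
  let k : ∀ i, (X.pullbackObj (ofOpensι (V i))).total ⟶ X.total := fun i =>
    pullbackSnd (ofOpensι (V i)) X.isIntervalBundle
  let l : ∀ i, (Y.pullbackObj (ofOpensι (V i))).total ⟶ Y.total := fun i =>
    pullbackSnd (ofOpensι (V i)) Y.isIntervalBundle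
  have hk : ∀ i, IsOpenEmb (k i) := fun i => isOpenEmb_pullbackSnd _ (isOpenEmb_ofOpensι _) _
  have hl : ∀ i, IsOpenEmb (l i) := fun i => isOpenEmb_pullbackSnd _ (isOpenEmb_ofOpensι _) _
  have hs : ∀ m, ∃ i a, k i a = m := fun m => by
    obtain ⟨i, hi⟩ := hV (X.proj m)
    exact ⟨i, (⟨⟨_, hi⟩, m, rfl⟩ : PullbackCarrier (ofOpensι (V i)) X.proj), rfl⟩
  obtain ⟨g, hg⟩ := exists_glue k hk hs (fun i => (α i).map ≫ l i) hα
  have hgp : ∀ i a, g (k i a) = PullbackCarrier.snd ((α i).map a) := fun i a =>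
    congrArg (fun f : (X.pullbackObj (ofOpensι (V i))).total ⟶ Y.total => f a) (hg i)
  have hw : ∀ m, Y.proj (g m) = X.proj m := by
    intro m
    obtain ⟨i, a, rfl⟩ := hs m
    refine (congrArg Y.proj (hgp i a)).trans ((PullbackCarrier.w _).symm.trans ?_)
    exact (congrArg Subtype.val ((α i).proj_map a)).trans (PullbackCarrier.w a)
  have w : g ≫ Y.proj = X.proj := Man.hom_ext hw
  have hloc : IsLocalDiffeomorph X.total.model Y.total.model ∞ g := by
    intro m
    obtain ⟨i, a, rfl⟩ := hs m
    -- The map `k i ≫ g` is the open embedding `(α i).map ≫ l i`; the local diffeomorphism `k i` is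
    -- cancelled.
    refine ((hk i).isLocalDiffeomorph a).of_comp ?_
    have h := ((α i).isOpenEmb.comp (hl i)).isLocalDiffeomorph a
    rw [← hg i] at h
    exact h
  have hinj : Function.Injective g := by
    intro m m' h
    -- Since `g` is a map over `U`, points with the same image lie in one fibre, hence over a single
    -- `V i`, where `α i` is injective.
    have hp : X.proj m = X.proj m' := (hw m).symm.trans ((congrArg Y.proj h).trans (hw m'))
    obtain ⟨i, hi⟩ := hV (X.proj m)
    let a : PullbackCarrier (ofOpensι (V i)) X.proj := ⟨⟨_, hi⟩, m, rfl⟩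
    let a' : PullbackCarrier (ofOpensι (V i)) X.proj := ⟨⟨_, hi⟩, m', hp⟩
    have h' : ((α i).map ≫ l i) a = ((α i).map ≫ l i) a' :=
      (hgp i a).symm.trans (h.trans (hgp i a'))
    exact congrArg PullbackCarrier.snd
      (((α i).isOpenEmb.comp (hl i)).isOpenEmbedding.injective h')
  have hf : Y.form.pullback g (𝟙 U) (w.trans (Category.comp_id _).symm) = X.form := by
    refine VerticalForm.ext_of_cover k hk (fun i => ofOpensι (V i))
      (fun i => isOpenEmb_ofOpensι _) (fun i => pullback_condition _ _) hs fun i => ?_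
    refine Eq.trans ?_ (α i).preserves
    have w' : (k i ≫ g) ≫ Y.proj = (X.pullbackObj (ofOpensι (V i))).proj ≫ ofOpensι (V i) := by
      rw [Category.assoc, w]
      exact pullback_condition _ _
    exact (VerticalForm.pullback_pullback _ _ _ _ _ _ _ w' rfl).trans
      (VerticalForm.pullback_pullback _ _ _ _ _ _ _ w' (hg i).symm).symm
  exact ⟨⟨g, w, hf, .of_injective hloc hinj⟩, fun i => pullbackObj_hom_ext fun p => hgp i p⟩

theorem full_toDescentData (hV : ∀ x, ∃ i, x ∈ V i) :
    (loc.{u}.toDescentData fun i => ofOpensι (V i)).Full := by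
  refine ⟨fun {X Y} α => ?_⟩
  let β : ∀ i, Family.pullbackObj (ofOpensι (V i)) X ⟶ Family.pullbackObj (ofOpensι (V i)) Y :=
    fun i => DescentData.Hom.hom α i
  obtain ⟨φ, hφ⟩ := exists_family_glue (X := X) (Y := Y) hV β fun i j a b hab => by
    have e : (PullbackCarrier.fst a).1 = (PullbackCarrier.fst b).1 :=
      (PullbackCarrier.w a).trans ((congrArg (Family.proj X) hab).trans (PullbackCarrier.w b).symm)
    let f₁ : ofOpens (V i ⊓ V j) ⟶ ofOpens (V i) := opensMap inf_le_left
    let f₂ : ofOpens (V i ⊓ V j) ⟶ ofOpens (V j) := opensMap inf_le_right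
    -- The points `a` and `b` represent the same point of `X`, lying over `V i ⊓ V j`. The
    -- compatibility of `α` is evaluated there at `p`; the transition maps on both sides fix the
    -- underlying points, and the one for `X` takes `p` to `b`.
    let p : PullbackCarrier f₁ (Family.pullbackObj (ofOpensι (V i)) X).proj :=
      ⟨⟨(PullbackCarrier.fst a).1, (PullbackCarrier.fst a).2, e ▸ (PullbackCarrier.fst b).2⟩, a, rfl⟩
    have h := congrArg (fun l : (Family.pullbackObj (ofOpensι (V i)) X).pullbackObj f₁ ⟶
      (Family.pullbackObj (ofOpensι (V j)) Y).pullbackObj f₂ =>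
        PullbackCarrier.snd (PullbackCarrier.snd (l.map p)))
      (DescentData.Hom.comm α (ofOpensι (V i ⊓ V j)) f₁ f₂ rfl rfl)
    refine (snd_snd_map_ofObj_hom (f := fun i => ofOpensι (V i)) Y _ f₁ f₂ rfl rfl _).symm.trans
      (h.trans (congrArg (fun c => PullbackCarrier.snd ((β j).map c))
        ((isOpenEmb_pullbackSnd _ (isOpenEmb_ofOpensι (V j))
          (Family.isIntervalBundle X)).isOpenEmbedding.injective
          ((snd_snd_map_ofObj_hom (f := fun i => ofOpensι (V i)) X _ f₁ f₂ rfl rfl p).trans hab))))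
  exact ⟨φ, DescentData.hom_ext hφ⟩

theorem isStack_loc : IsStack.{u, w, u, u + 1} loc.{u} := by
  intro U ι V hV
  have hV' : ∀ x, ∃ i, x ∈ V i := fun x => Opens.mem_iSup.1 (hV ▸ Opens.mem_top x)
  have := essSurj_toDescentData hV'
  have := faithful_toDescentData hV'
  have := full_toDescentData hV'
  exact {}

end Stack

end

end SmoothLoc

theorem mainTheorem7 : SmoothLoc.IsStack.{u, w, u, u + 1} SmoothLoc.loc.{u} := by
  exact SmoothLoc.isStack_loc
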